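/- For $N\ge 1$ let $G_N=\frac{1}{\sqrt{2N}}(X_N+\mathrm{i}Y_N)$ be an $N\times N$ complex Ginibre matrix, where $X_N$ and $Y_N$ are independent $N\times N$ real random matrices, each with independent and identically distributed standard Gaussian entries; all random variables live on one probability space. Let $b_N$ be a random vector in $\mathbb{C}^N$ that is independent of $G_N$ and almost surely nonzero. Let $\sigma\in(0,1)$, let $k\ge 0$ be a fixed integer, set $A_N=I+\sigma G_N$, and let $$\|r_N^{(k)}\|=\min_{p\in\mathbb{C}[z],\ \deg p<k}\|b_N-A_N\,p(A_N)\,b_N\|$$ (Euclidean norm, with $p=0$ allowed) be the residual norm at step $k$ of GMRES applied to the linear system $A_Nx=b_N$. Then $$\frac{\|r_N^{(k)}\|}{\|b_N\|}\longrightarrow\left(\frac{1-\sigma^2}{1-\sigma^{2+2k}}\right)^{1/2}\sigma^k\qquad\text{in probability as }N\to\infty.$$ -/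

import Mathlib

open MeasureTheory ProbabilityTheory Filter
open scoped Matrix Polynomial

/-- `G` is an `N × N` complex Ginibre matrix on `(Ω, P)`: `G = (2N)^{-1/2} (X + i Y)`, where `X` and
`Y` are independent real random matrices, each with i.i.d. standard Gaussian entries. -/
def IsGinibre {Ω : Type*} [MeasurableSpace Ω] (P : Measure Ω) {N : ℕ}
    (G : Ω → Matrix (Fin N) (Fin N) ℂ) : Prop :=
  ∃ X Y : Ω → Matrix (Fin N) (Fin N) ℝ,
    (∀ i j, HasLaw (fun ω => X ω i j) (gaussianReal 0 1) P) ∧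
    (∀ i j, HasLaw (fun ω => Y ω i j) (gaussianReal 0 1) P) ∧
    iIndepFun (fun (ij : Fin N × Fin N) ω => X ω ij.1 ij.2) P ∧
    iIndepFun (fun (ij : Fin N × Fin N) ω => Y ω ij.1 ij.2) P ∧
    IndepFun (fun ω i j => X ω i j) (fun ω i j => Y ω i j) P ∧
    ∀ ω i j, G ω i j = ((√(2 * N) : ℝ) : ℂ)⁻¹ * ((X ω i j : ℂ) + Complex.I * (Y ω i j : ℂ))

/-- The residual norms `‖b - A p(A) b‖` (Euclidean norm) of the approximations `p(A) b` to the
solution of `A x = b`, where `p` is a complex polynomial of degree less than `k`. -/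
def krylovResidualNorms {N : ℕ} (A : Matrix (Fin N) (Fin N) ℂ) (b : EuclideanSpace ℂ (Fin N))
    (k : ℕ) : Set ℝ :=
  {r | ∃ p : ℂ[X], p.degree < (k : WithBot ℕ) ∧
    r = ‖b - WithLp.toLp 2 (A *ᵥ (Polynomial.aeval A p *ᵥ b.ofLp))‖}

/-- The norm of the step `k` GMRES residual for `A x = b`. -/
noncomputable def gmresResidualNorm {N : ℕ} (A : Matrix (Fin N) (Fin N) ℂ)
    (b : EuclideanSpace ℂ (Fin N)) (k : ℕ) : ℝ :=
  sInf (krylovResidualNorms A b k)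

/-- The infimum that defines the GMRES residual norm is a minimum. -/
theorem gmresResidualNorm_isLeast {N : ℕ} (A : Matrix (Fin N) (Fin N) ℂ)
    (b : EuclideanSpace ℂ (Fin N)) (k : ℕ) :
    IsLeast (krylovResidualNorms A b k) (gmresResidualNorm A b k) := by
  let L : ℂ[X] →ₗ[ℂ] EuclideanSpace ℂ (Fin N) :=
    { toFun := fun p => WithLp.toLp 2 (A *ᵥ (Polynomial.aeval A p *ᵥ b.ofLp))
      map_add' := fun p q => by
        simp [map_add, Matrix.add_mulVec, Matrix.mulVec_add]
      map_smul' := fun c p => by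
        simp [map_smul, Matrix.smul_mulVec, Matrix.mulVec_smul] }
  let K : Submodule ℂ (EuclideanSpace ℂ (Fin N)) := (Polynomial.degreeLT ℂ k).map L
  have hne : (krylovResidualNorms A b k).Nonempty :=
    ⟨_, 0, by simp, rfl⟩
  have hbd : BddBelow (krylovResidualNorms A b k) :=
    ⟨0, by rintro _ ⟨p, -, rfl⟩; exact norm_nonneg _⟩
  have hmem : K.starProjection b ∈ K := Submodule.starProjection_apply_mem K b
  obtain ⟨p, hp, hpe⟩ := hmem
  have hpk : ‖b - K.starProjection b‖ ∈ krylovResidualNorms A b k :=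
    ⟨p, Polynomial.mem_degreeLT.1 hp, by rw [← hpe]; rfl⟩
  have hmin : ∀ r ∈ krylovResidualNorms A b k, ‖b - K.starProjection b‖ ≤ r := by
    rintro _ ⟨q, hq, rfl⟩
    rw [Submodule.starProjection_minimal]
    exact ciInf_le (f := fun x : K => ‖b - x‖) ⟨0, by rintro _ ⟨x, rfl⟩; exact norm_nonneg _⟩
      ⟨L q, q, Polynomial.mem_degreeLT.2 hq, rfl⟩
  have h : gmresResidualNorm A b k = ‖b - K.starProjection b‖ :=
    le_antisymm (csInf_le hbd hpk) (le_csInf hne hmin)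
  rw [h]
  exact ⟨hpk, hmin⟩

/-!
Writing `p(z)` in terms of `G = σ⁻¹ (A - 1)`, the residual polynomials of GMRES become the
polynomials `∑_{i ≤ k} c i * x ^ i` with value `1` at `x = -σ⁻¹`. So the residual norm is the
minimum of `‖∑ i, c i • G ^ i b‖` under one linear constraint on `c`. If the vectors `G ^ i b / ‖b‖`
were orthonormal, Cauchy–Schwarz would give the minimum `(∑_{i ≤ k} |σ| ^ (-2 * i)) ^ (-1/2) * ‖b‖`,
and the error is controlled by the distance of their Gram matrix from the identity.

It remains to see that this Gram matrix tends to the identity in probability. Run the Arnoldi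
process on `G` and `b`, with vectors `e 0, e 1, …`. The first `j + 1` of them depend on `G` only
through its restriction to the span of `e 0, …, e (j - 1)`, and the law of `G` does not change when
`G` is replaced by an independent copy on the orthogonal complement of this span, which contains
`e j`. Hence `G e j` behaves like the image of a fixed unit vector, a Gaussian vector of norm close
to `1` and almost orthogonal to each of `e 0, …, e j`. In the limit `G` therefore acts as the shift
`e j ↦ e (j + 1)`, and `G ^ i b / ‖b‖` becomes `e i`.
-/

open scoped ENNReal Topology InnerProductSpace

section InMeasure

variable {ι Ω : Type*} [MeasurableSpace Ω] {P : Measure Ω} {l : Filter ι}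

/-- The filter on `ι × Ω` along which convergence of `fun z => X z.1 z.2` is convergence in measure
of the family `X i` along `l`. It turns the calculus of limits in probability into that of
`Filter.Tendsto`. -/
def inMeasure (P : Measure Ω) (l : Filter ι) : Filter (ι × Ω) where
  sets := {S | Tendsto (fun i => P {ω | (i, ω) ∉ S}) l (𝓝 0)}
  univ_sets := by simpa using tendsto_const_nhds
  sets_of_superset hS hST :=
    tendsto_of_tendsto_of_tendsto_of_le_of_le tendsto_const_nhds hS (fun _ => zero_le)
      fun _ => measure_mono fun _ hω h => hω (hST h)
  inter_sets {S T} hS hT := by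
    refine tendsto_of_tendsto_of_tendsto_of_le_of_le tendsto_const_nhds
      (by simpa using hS.add hT) (fun _ => zero_le) fun i => ?_
    refine (measure_mono fun ω hω => ?_).trans (measure_union_le {ω | (i, ω) ∉ S} {ω | (i, ω) ∉ T})
    simpa only [Set.mem_union, Set.mem_ofPred_eq, Set.mem_inter_iff, not_and_or] using hω

theorem mem_inMeasure {S : Set (ι × Ω)} :
    S ∈ inMeasure P l ↔ Tendsto (fun i => P {ω | (i, ω) ∉ S}) l (𝓝 0) :=
  Iff.rfl

theorem tendstoInMeasure_const_iff {E : Type*} [PseudoMetricSpace E] {X : ι → Ω → E} {c : E} :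
    TendstoInMeasure P X l (fun _ => c) ↔
      Tendsto (fun z : ι × Ω => X z.1 z.2) (inMeasure P l) (𝓝 c) := by
  rw [tendstoInMeasure_iff_dist, Metric.tendsto_nhds]
  simp only [Filter.Eventually, mem_inMeasure, Set.mem_ofPred_eq, not_lt]

theorem eventually_inMeasure_of_ae {p : ι × Ω → Prop} (h : ∀ᶠ i in l, ∀ᵐ ω ∂P, p (i, ω)) :
    ∀ᶠ z in inMeasure P l, p z :=
  mem_inMeasure.2 (tendsto_const_nhds.congr' (h.mono fun _ hi => hi.symm))

theorem tendsto_inMeasure_zero_of_lintegral_enorm_sq {E : Type*} [NormedAddCommGroup E]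
    {X : ι → Ω → E} (hX : ∀ i, AEStronglyMeasurable (X i) P)
    (h : Tendsto (fun i => ∫⁻ ω, ‖X i ω‖ₑ ^ 2 ∂P) l (𝓝 0)) :
    Tendsto (fun z : ι × Ω => X z.1 z.2) (inMeasure P l) (𝓝 0) := by
  refine tendstoInMeasure_const_iff.1 (tendstoInMeasure_of_tendsto_eLpNorm two_ne_zero hX
    aestronglyMeasurable_const ?_)
  have hsqrt := h.ennrpow_const (1 / 2 : ℝ)
  rw [ENNReal.zero_rpow_of_pos one_half_pos] at hsqrt
  refine hsqrt.congr fun i => ?_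
  rw [eLpNorm_eq_lintegral_rpow_enorm_toReal two_ne_zero ENNReal.ofNat_ne_top]
  simp

end InMeasure

section GramPerturbation

variable {𝕜 E ι : Type*} [RCLike 𝕜] [SeminormedAddCommGroup E] [InnerProductSpace 𝕜 E]
  {s : Finset ι}

open ComplexConjugate in
theorem abs_norm_sum_smul_sq_sub_le [DecidableEq ι] (s : Finset ι) (c : ι → 𝕜) (v : ι → E) :
    |‖∑ i ∈ s, c i • v i‖ ^ 2 - ∑ i ∈ s, ‖c i‖ ^ 2| ≤
      (∑ i ∈ s, ∑ j ∈ s, ‖⟪v i, v j⟫_𝕜 - if i = j then 1 else 0‖) * ∑ i ∈ s, ‖c i‖ ^ 2 := by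
  have hexpand : ((‖∑ i ∈ s, c i • v i‖ ^ 2 - ∑ i ∈ s, ‖c i‖ ^ 2 : ℝ) : 𝕜) =
      ∑ i ∈ s, ∑ j ∈ s, conj (c i) * c j * (⟪v i, v j⟫_𝕜 - if i = j then 1 else 0) := by
    push_cast
    rw [← inner_self_eq_norm_sq_to_K (𝕜 := 𝕜), sum_inner]
    simp only [inner_sum, inner_smul_left, inner_smul_right, mul_sub,
      Finset.sum_sub_distrib, mul_ite, mul_one, mul_zero, Finset.sum_ite_eq]
    congr 1
    · exact Finset.sum_congr rfl fun i _ => Finset.sum_congr rfl fun j _ => by ring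
    · exact Finset.sum_congr rfl fun i hi => by rw [if_pos hi, RCLike.conj_mul]
  have hcoeff {i j : ι} (hi : i ∈ s) (hj : j ∈ s) : ‖c i‖ * ‖c j‖ ≤ ∑ i ∈ s, ‖c i‖ ^ 2 := by
    have hsingle {i : ι} (hi : i ∈ s) : ‖c i‖ ^ 2 ≤ ∑ i ∈ s, ‖c i‖ ^ 2 :=
      Finset.single_le_sum (f := fun i => ‖c i‖ ^ 2) (fun _ _ => sq_nonneg _) hi
    linarith [two_mul_le_add_sq ‖c i‖ ‖c j‖, hsingle hi, hsingle hj]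
  rw [← RCLike.norm_ofReal (K := 𝕜), hexpand, Finset.sum_mul]
  refine norm_sum_le_of_le s fun i hi => ?_
  rw [Finset.sum_mul]
  refine norm_sum_le_of_le s fun j hj => ?_
  rw [norm_mul, norm_mul, RCLike.norm_conj, mul_comm]
  gcongr
  exact hcoeff hi hj

theorem sum_norm_sq_pos_of_sum_mul_eq_one {a c : ι → 𝕜} (h : ∑ i ∈ s, c i * a i = 1) :
    0 < ∑ i ∈ s, ‖a i‖ ^ 2 := by
  obtain ⟨i, hi, hne⟩ := Finset.exists_ne_zero_of_sum_ne_zero (h.trans_ne one_ne_zero)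
  exact Finset.sum_pos' (fun _ _ => sq_nonneg _)
    ⟨i, hi, pow_pos (norm_pos_iff.2 (right_ne_zero_of_mul hne)) 2⟩

theorem inv_sum_norm_sq_le_of_sum_mul_eq_one {a c : ι → 𝕜} (h : ∑ i ∈ s, c i * a i = 1) :
    (∑ i ∈ s, ‖a i‖ ^ 2)⁻¹ ≤ ∑ i ∈ s, ‖c i‖ ^ 2 := by
  have hone : (1 : ℝ) ≤ ∑ i ∈ s, ‖c i‖ * ‖a i‖ := by
    simpa only [h, norm_one, norm_mul] using norm_sum_le s fun i => c i * a i
  rw [inv_le_iff_one_le_mul₀ (sum_norm_sq_pos_of_sum_mul_eq_one h)]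
  exact (one_le_pow₀ hone).trans (Finset.sum_mul_sq_le_sq_mul_sq s _ _)

open ComplexConjugate in
/-- By Cauchy–Schwarz, for orthonormal vectors the minimum is attained at the multiple
`c = (∑ i, ‖a i‖²)⁻¹ • conj a` of the conjugate constraint vector. -/
theorem abs_sq_sub_inv_sum_norm_sq_le_of_isLeast [DecidableEq ι] {a : ι → 𝕜} {v : ι → E} {ρ : ℝ}
    (hρ : IsLeast {r | ∃ c : ι → 𝕜, ∑ i ∈ s, c i * a i = 1 ∧ r = ‖∑ i ∈ s, c i • v i‖} ρ) :
    |ρ ^ 2 - (∑ i ∈ s, ‖a i‖ ^ 2)⁻¹| ≤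
      (∑ i ∈ s, ∑ j ∈ s, ‖⟪v i, v j⟫_𝕜 - if i = j then 1 else 0‖) *
        (∑ i ∈ s, ‖a i‖ ^ 2)⁻¹ := by
  obtain ⟨⟨c, hc, hρc⟩, hmin⟩ := hρ
  set η := ∑ i ∈ s, ∑ j ∈ s, ‖⟪v i, v j⟫_𝕜 - if i = j then 1 else 0‖
  set S := ∑ i ∈ s, ‖a i‖ ^ 2 with hS
  have hS0 : 0 < S := sum_norm_sq_pos_of_sum_mul_eq_one hc
  have hlower : (1 - η) * S⁻¹ ≤ ρ ^ 2 := by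
    have hperturb := (abs_le.1 (abs_norm_sum_smul_sq_sub_le s c v)).1
    rw [← hρc] at hperturb
    rcases le_total η 1 with hη | hη
    · have := mul_le_mul_of_nonneg_left (inv_sum_norm_sq_le_of_sum_mul_eq_one hc)
        (sub_nonneg.2 hη)
      linarith
    · exact (mul_nonpos_of_nonpos_of_nonneg (sub_nonpos.2 hη) (inv_nonneg.2 hS0.le)).trans
        (sq_nonneg ρ)
  have hupper : ρ ^ 2 ≤ (1 + η) * S⁻¹ := by
    let d : ι → 𝕜 := fun i => (S⁻¹ : ℝ) * conj (a i)
    have hd : ∑ i ∈ s, d i * a i = 1 := by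
      simp only [d, mul_assoc, RCLike.conj_mul, ← Finset.mul_sum]
      exact_mod_cast inv_mul_cancel₀ hS0.ne'
    have hnorm : ∑ i ∈ s, ‖d i‖ ^ 2 = S⁻¹ := by
      simp only [d, norm_mul, RCLike.norm_ofReal, RCLike.norm_conj, mul_pow, sq_abs,
        ← Finset.mul_sum, ← hS]
      field_simp
    have hρ0 : 0 ≤ ρ := hρc ▸ norm_nonneg _
    have hperturb := (abs_le.1 (abs_norm_sum_smul_sq_sub_le s d v)).2
    rw [hnorm] at hperturb
    linarith [pow_le_pow_left₀ hρ0 (hmin ⟨d, hd, rfl⟩) 2]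
  rw [abs_le]
  constructor <;> linarith

end GramPerturbation

section Gmres

open Polynomial in
/-- The substitution `z = 1 + σ x` turns GMRES residual polynomials, normalised at `z = 0`, into
polynomials normalised at `x = -σ⁻¹`. -/
theorem exists_one_sub_X_mul_comp_eq_iff {K : Type*} [Field K] {σ : K} (hσ : σ ≠ 0) {k : ℕ}
    {q : K[X]} :
    (∃ p : K[X], p.degree < k ∧ (1 - X * p).comp (1 + C σ * X) = q) ↔
      q.natDegree ≤ k ∧ q.eval (-σ⁻¹) = 1 := by
  constructor
  · rintro ⟨p, hp, rfl⟩
    have hlin : (1 + C σ * X : K[X]).natDegree ≤ 1 := by compute_degree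
    have hdeg : (1 - X * p).natDegree ≤ k := by
      refine (natDegree_sub_le _ _).trans (max_le (by simp) ?_)
      rcases eq_or_ne p 0 with rfl | hp0
      · simp
      · rw [natDegree_X_mul hp0]
        exact (natDegree_lt_iff_degree_lt hp0).2 hp
    exact ⟨natDegree_comp_le.trans ((Nat.mul_le_mul hdeg hlin).trans_eq (mul_one k)), by simp [hσ]⟩
  · rintro ⟨hdeg, heval⟩
    let r : K[X] := q.comp (C σ⁻¹ * (X - 1))
    have hlin : (C σ⁻¹ * (X - 1) : K[X]).natDegree ≤ 1 := by compute_degree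
    have hr : (1 - r).natDegree ≤ k := (natDegree_sub_le _ _).trans (max_le (by simp)
      (natDegree_comp_le.trans ((Nat.mul_le_mul hdeg hlin).trans_eq (mul_one k))))
    have hdvd : X * divX (1 - r) = 1 - r := by
      have hcoeff : (1 - r).coeff 0 = 0 := by simp [r, coeff_zero_eq_eval_zero, heval]
      conv_rhs => rw [← X_mul_divX_add (1 - r), hcoeff, C_0, add_zero]
    refine ⟨divX (1 - r), (degree_lt_iff_coeff_zero _ _).2 fun m hm => ?_, ?_⟩
    · rw [coeff_divX]
      exact coeff_eq_zero_of_natDegree_lt (by omega)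
    · rw [hdvd, sub_sub_cancel, comp_assoc]
      simp [← mul_assoc, ← C_mul, hσ]

open Polynomial in
theorem exists_degree_lt_aeval_one_add_smul_eq_iff {K A : Type*} [Field K] [Ring A] [Algebra K A]
    {σ : K} (hσ : σ ≠ 0) {k : ℕ} {T y : A} :
    (∃ p : K[X], p.degree < k ∧ aeval (1 + σ • T) (1 - X * p) = y) ↔
      ∃ c : ℕ → K, ∑ i ∈ Finset.range (k + 1), c i * (-σ⁻¹) ^ i = 1 ∧
        ∑ i ∈ Finset.range (k + 1), c i • T ^ i = y := by
  have hcomp (p : K[X]) :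
      aeval (1 + σ • T) (1 - X * p) = aeval T ((1 - X * p).comp (1 + C σ * X)) := by
    rw [aeval_comp]
    simp [Algebra.smul_def]
  constructor
  · rintro ⟨p, hp, rfl⟩
    obtain ⟨hdeg, heval⟩ := (exists_one_sub_X_mul_comp_eq_iff hσ).1 ⟨p, hp, rfl⟩
    rw [← Nat.lt_succ_iff] at hdeg
    refine ⟨((1 - X * p).comp (1 + C σ * X)).coeff, ?_, ?_⟩
    · rw [← heval, eval_eq_sum_range' hdeg]
    · rw [hcomp, aeval_eq_sum_range' hdeg]
  · rintro ⟨c, hc, rfl⟩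
    let q : K[X] := ∑ i ∈ Finset.range (k + 1), C (c i) * X ^ i
    have hdeg : q.natDegree ≤ k := natDegree_sum_le_of_forall_le _ _ fun i hi =>
      (natDegree_C_mul_X_pow_le _ _).trans (Nat.lt_succ_iff.1 (Finset.mem_range.1 hi))
    have heval : q.eval (-σ⁻¹) = 1 := by simp [q, eval_finsetSum, hc]
    obtain ⟨p, hp, hpq⟩ := (exists_one_sub_X_mul_comp_eq_iff hσ).2 ⟨hdeg, heval⟩
    exact ⟨p, hp, by rw [hcomp, hpq]; simp [q, Algebra.smul_def]⟩

variable {N : ℕ}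

theorem sub_toLp_mulVec_aeval_eq (A : Matrix (Fin N) (Fin N) ℂ) (b : EuclideanSpace ℂ (Fin N))
    (p : ℂ[X]) :
    b - WithLp.toLp 2 (A *ᵥ (Polynomial.aeval A p *ᵥ b.ofLp)) =
      Polynomial.aeval (Matrix.toEuclideanCLM (𝕜 := ℂ) A) (1 - Polynomial.X * p) b := by
  rw [Polynomial.aeval_algHom_apply, map_sub, map_one, map_mul, Polynomial.aeval_X, map_sub,
    map_one, Matrix.mulVec_mulVec]
  rfl

theorem krylovResidualNorms_one_add_smul_eq (G : Matrix (Fin N) (Fin N) ℂ)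
    (b : EuclideanSpace ℂ (Fin N)) {σ : ℂ} (hσ : σ ≠ 0) (k : ℕ) :
    krylovResidualNorms (1 + σ • G) b k =
      {r | ∃ c : ℕ → ℂ, ∑ i ∈ Finset.range (k + 1), c i * (-σ⁻¹) ^ i = 1 ∧
        r = ‖∑ i ∈ Finset.range (k + 1), c i • (Matrix.toEuclideanCLM (𝕜 := ℂ) G ^ i) b‖} := by
  ext r
  simp only [krylovResidualNorms, sub_toLp_mulVec_aeval_eq, map_add, map_one, map_smul,
    Set.mem_ofPred_eq]
  constructor
  · rintro ⟨p, hp, rfl⟩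
    obtain ⟨c, hc, hcp⟩ := (exists_degree_lt_aeval_one_add_smul_eq_iff hσ
      (T := Matrix.toEuclideanCLM (𝕜 := ℂ) G)).1 ⟨p, hp, rfl⟩
    exact ⟨c, hc, by rw [← hcp]; simp⟩
  · rintro ⟨c, hc, rfl⟩
    obtain ⟨p, hp, hcp⟩ := (exists_degree_lt_aeval_one_add_smul_eq_iff hσ
      (T := Matrix.toEuclideanCLM (𝕜 := ℂ) G)).2 ⟨c, hc, rfl⟩
    exact ⟨p, hp, by rw [hcp]; simp⟩

theorem abs_gmresResidualNorm_div_sq_sub_le (G : Matrix (Fin N) (Fin N) ℂ)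
    {b : EuclideanSpace ℂ (Fin N)} (hb : b ≠ 0) {σ : ℂ} (hσ : σ ≠ 0) (k : ℕ) :
    |(gmresResidualNorm (1 + σ • G) b k / ‖b‖) ^ 2 -
        (∑ i ∈ Finset.range (k + 1), ‖(-σ⁻¹) ^ i‖ ^ 2)⁻¹| ≤
      (∑ i ∈ Finset.range (k + 1), ∑ j ∈ Finset.range (k + 1),
        ‖⟪(Matrix.toEuclideanCLM (𝕜 := ℂ) G ^ i) ((‖b‖ : ℂ)⁻¹ • b),
          (Matrix.toEuclideanCLM (𝕜 := ℂ) G ^ j) ((‖b‖ : ℂ)⁻¹ • b)⟫_ℂ - if i = j then 1 else 0‖) *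
        (∑ i ∈ Finset.range (k + 1), ‖(-σ⁻¹) ^ i‖ ^ 2)⁻¹ := by
  apply abs_sq_sub_inv_sum_norm_sq_le_of_isLeast
  have hleast := gmresResidualNorm_isLeast (1 + σ • G) b k
  rw [krylovResidualNorms_one_add_smul_eq G b hσ k] at hleast
  have hscale (c : ℕ → ℂ) :
      ‖∑ i ∈ Finset.range (k + 1), c i • (Matrix.toEuclideanCLM (𝕜 := ℂ) G ^ i)
        ((‖b‖ : ℂ)⁻¹ • b)‖ =
      ‖∑ i ∈ Finset.range (k + 1), c i • (Matrix.toEuclideanCLM (𝕜 := ℂ) G ^ i) b‖ / ‖b‖ := by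
    simp only [map_smul, smul_comm _ (‖b‖ : ℂ)⁻¹, ← Finset.smul_sum]
    rw [norm_smul, norm_inv, Complex.norm_real, norm_norm, div_eq_inv_mul]
  simp only [hscale]
  obtain ⟨⟨c, hc, hρ⟩, hmin⟩ := hleast
  refine ⟨⟨c, hc, by rw [hρ]⟩, ?_⟩
  rintro _ ⟨d, hd, rfl⟩
  gcongr
  exact hmin ⟨d, hd, rfl⟩

theorem gmresResidualNorm_nonneg (A : Matrix (Fin N) (Fin N) ℂ) (b : EuclideanSpace ℂ (Fin N))
    (k : ℕ) : 0 ≤ gmresResidualNorm A b k := by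
  obtain ⟨p, -, hp⟩ := (gmresResidualNorm_isLeast A b k).1
  exact hp ▸ norm_nonneg _

theorem inv_sum_norm_neg_inv_pow_sq_eq_div {σ : ℂ} (hσ : σ ≠ 0) (k : ℕ) :
    (∑ i ∈ Finset.range (k + 1), ‖(-σ⁻¹) ^ i‖ ^ 2)⁻¹ =
      (‖σ‖ ^ k) ^ 2 / ∑ i ∈ Finset.range (k + 1), ‖σ‖ ^ (2 * i) := by
  have hreverse : ∑ i ∈ Finset.range (k + 1), ‖σ‖ ^ (2 * i) =
      (‖σ‖ ^ k) ^ 2 * ∑ i ∈ Finset.range (k + 1), ‖(-σ⁻¹) ^ i‖ ^ 2 := by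
    rw [Finset.mul_sum, ← Finset.sum_flip]
    refine Finset.sum_congr rfl fun i hi => ?_
    rw [norm_pow, norm_neg, norm_inv, pow_mul', pow_sub₀ _ (norm_ne_zero_iff.2 hσ)
      (Finset.mem_range_succ_iff.1 hi), mul_pow, inv_pow, inv_pow, inv_pow]
  have hpow : (‖σ‖ ^ k) ^ 2 ≠ 0 := pow_ne_zero 2 (pow_ne_zero k (norm_ne_zero_iff.2 hσ))
  rw [hreverse, ← div_div, div_self hpow, one_div]

theorem sqrt_inv_geom_sum_mul_pow_eq {x : ℝ} (hx : x ∈ Set.Ioo (0 : ℝ) 1) (k : ℕ) :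
    √((1 - x ^ 2) / (1 - x ^ (2 + 2 * k))) * x ^ k =
      x ^ k / √(∑ i ∈ Finset.range (k + 1), x ^ (2 * i)) := by
  have hx2 : x ^ 2 ≠ 1 := (pow_lt_one₀ hx.1.le hx.2 two_ne_zero).ne
  have hgeom : ∑ i ∈ Finset.range (k + 1), x ^ (2 * i) =
      (1 - x ^ (2 + 2 * k)) / (1 - x ^ 2) := by
    simp only [pow_mul, geom_sum_eq hx2]
    rw [← neg_div_neg_eq, neg_sub, neg_sub, ← pow_mul, mul_add_one, add_comm]
  rw [hgeom, div_eq_mul_inv (x ^ k), ← Real.sqrt_inv, inv_div, mul_comm]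

end Gmres

section Arnoldi

open InnerProductSpace

variable {𝕜 E : Type*} [RCLike 𝕜] [NormedAddCommGroup E] [InnerProductSpace 𝕜 E]

/-- The state of the Arnoldi process for an operator `T` and a start vector `b` before the vector
number `j` is normalised: the orthogonal projection onto the span of the vectors found so far, and
the next vector, already orthogonal to that span. -/
noncomputable def arnoldiState (T : E →L[𝕜] E) (b : E) : ℕ → (E →L[𝕜] E) × E
  | 0 => (0, b)
  | j + 1 =>
    let v := ((‖(arnoldiState T b j).2‖ : 𝕜)⁻¹ • (arnoldiState T b j).2 : E)
    let Q := (arnoldiState T b j).1 + rankOne 𝕜 v v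
    (Q, T v - Q (T v))

/-- The orthogonal projection onto the span of the first `j` Arnoldi vectors. -/
noncomputable def arnoldiProj (T : E →L[𝕜] E) (b : E) (j : ℕ) : E →L[𝕜] E :=
  (arnoldiState T b j).1

/-- The component of `T e_{j-1}` (for `j = 0`, of the start vector) orthogonal to the first `j`
Arnoldi vectors. -/
noncomputable def arnoldiResidual (T : E →L[𝕜] E) (b : E) (j : ℕ) : E :=
  (arnoldiState T b j).2

/-- The Arnoldi vectors: an orthonormal basis of the Krylov space of `T` and `b`, continued by
zeros once the Krylov space is exhausted. -/
noncomputable def arnoldiVec (T : E →L[𝕜] E) (b : E) (j : ℕ) : E :=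
  (‖arnoldiResidual T b j‖ : 𝕜)⁻¹ • arnoldiResidual T b j

variable (T : E →L[𝕜] E) (b : E)

theorem arnoldiProj_succ (j : ℕ) : arnoldiProj T b (j + 1) =
    arnoldiProj T b j + rankOne 𝕜 (arnoldiVec T b j) (arnoldiVec T b j) :=
  rfl

theorem arnoldiResidual_succ (j : ℕ) : arnoldiResidual T b (j + 1) =
    T (arnoldiVec T b j) - arnoldiProj T b (j + 1) (T (arnoldiVec T b j)) :=
  rfl

theorem norm_arnoldiVec (j : ℕ) :
    ‖arnoldiVec T b j‖ = ‖arnoldiResidual T b j‖⁻¹ * ‖arnoldiResidual T b j‖ := by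
  rw [arnoldiVec, norm_smul, norm_inv, RCLike.norm_ofReal, abs_norm]

theorem norm_arnoldiVec_le_one (j : ℕ) : ‖arnoldiVec T b j‖ ≤ 1 :=
  (norm_arnoldiVec T b j).trans_le inv_mul_le_one

theorem norm_arnoldiVec_zero {b : E} (hb : b ≠ 0) : ‖arnoldiVec T b 0‖ = 1 :=
  (norm_arnoldiVec T b 0).trans (inv_mul_cancel₀ (norm_ne_zero_iff.2 hb))

theorem arnoldiVec_eq_zero_or_norm_eq_one (j : ℕ) :
    arnoldiVec T b j = 0 ∨ ‖arnoldiVec T b j‖ = 1 := by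
  rcases eq_or_ne (arnoldiResidual T b j) 0 with h | h
  · exact .inl (by rw [arnoldiVec, h, smul_zero])
  · exact .inr ((norm_arnoldiVec T b j).trans (inv_mul_cancel₀ (norm_ne_zero_iff.2 h)))

theorem inner_arnoldiVec_self_smul (j : ℕ) :
    ⟪arnoldiVec T b j, arnoldiVec T b j⟫_𝕜 • arnoldiVec T b j = arnoldiVec T b j := by
  rcases arnoldiVec_eq_zero_or_norm_eq_one T b j with h | h
  · rw [h, smul_zero]
  · rw [inner_self_eq_norm_sq_to_K, h, RCLike.ofReal_one, one_pow, one_smul]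

theorem norm_smul_arnoldiVec (j : ℕ) :
    (‖arnoldiResidual T b j‖ : 𝕜) • arnoldiVec T b j = arnoldiResidual T b j := by
  rcases eq_or_ne (arnoldiResidual T b j) 0 with h | h
  · rw [arnoldiVec, h, smul_zero, smul_zero]
  · exact smul_inv_smul₀ (RCLike.ofReal_ne_zero.2 (norm_ne_zero_iff.2 h)) _

theorem apply_arnoldiVec_eq (j : ℕ) : T (arnoldiVec T b j) =
    arnoldiProj T b (j + 1) (T (arnoldiVec T b j)) +
      (‖arnoldiResidual T b (j + 1)‖ : 𝕜) • arnoldiVec T b (j + 1) := by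
  rw [norm_smul_arnoldiVec, arnoldiResidual_succ, add_sub_cancel]

theorem arnoldiProj_eq_sum (j : ℕ) : arnoldiProj T b j =
    ∑ i ∈ Finset.range j, rankOne 𝕜 (arnoldiVec T b i) (arnoldiVec T b i) := by
  induction j with
  | zero => rfl
  | succ j ih => rw [arnoldiProj_succ, Finset.sum_range_succ, ih]

theorem arnoldiProj_apply (j : ℕ) (x : E) : arnoldiProj T b j x =
    ∑ i ∈ Finset.range j, ⟪arnoldiVec T b i, x⟫_𝕜 • arnoldiVec T b i := by
  rw [arnoldiProj_eq_sum, _root_.sum_apply]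
  simp only [rankOne_apply]

variable [CompleteSpace E]

theorem isStarProjection_rankOne_arnoldiVec (j : ℕ) :
    IsStarProjection (rankOne 𝕜 (arnoldiVec T b j) (arnoldiVec T b j)) := by
  rcases arnoldiVec_eq_zero_or_norm_eq_one T b j with h | h
  · simpa only [h, map_zero] using IsStarProjection.zero _
  · exact isStarProjection_rankOne_self h

theorem isStarProjection_arnoldiProj_and_apply_arnoldiVec (j : ℕ) :
    IsStarProjection (arnoldiProj T b j) ∧ arnoldiProj T b j (arnoldiVec T b j) = 0 := by
  induction j with
  | zero => exact ⟨IsStarProjection.zero _, rfl⟩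
  | succ j ih =>
    have hproj : IsStarProjection (arnoldiProj T b (j + 1)) := by
      rw [arnoldiProj_succ]
      refine ih.1.add (isStarProjection_rankOne_arnoldiVec T b j) ?_
      rw [ContinuousLinearMap.mul_def, comp_rankOne, ih.2, map_zero, zero_apply]
    have hidem (x : E) : arnoldiProj T b (j + 1) (arnoldiProj T b (j + 1) x) =
        arnoldiProj T b (j + 1) x :=
      DFunLike.congr_fun hproj.isIdempotentElem x
    refine ⟨hproj, ?_⟩
    rw [arnoldiVec, arnoldiResidual_succ, map_smul, map_sub, hidem, sub_self, smul_zero]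

theorem isStarProjection_arnoldiProj (j : ℕ) : IsStarProjection (arnoldiProj T b j) :=
  (isStarProjection_arnoldiProj_and_apply_arnoldiVec T b j).1

theorem arnoldiProj_apply_arnoldiVec_self (j : ℕ) : arnoldiProj T b j (arnoldiVec T b j) = 0 :=
  (isStarProjection_arnoldiProj_and_apply_arnoldiVec T b j).2

theorem inner_arnoldiProj_left (j : ℕ) (x y : E) :
    ⟪arnoldiProj T b j x, y⟫_𝕜 = ⟪x, arnoldiProj T b j y⟫_𝕜 :=
  (isStarProjection_arnoldiProj T b j).isSelfAdjoint.isSymmetric x y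

theorem arnoldiProj_apply_arnoldiProj {i j : ℕ} (hij : i ≤ j) (x : E) :
    arnoldiProj T b j (arnoldiProj T b i x) = arnoldiProj T b i x := by
  induction j, hij using Nat.le_induction with
  | base => exact DFunLike.congr_fun (isStarProjection_arnoldiProj T b i).isIdempotentElem x
  | succ j _ ih =>
    have horth : ⟪arnoldiVec T b j, arnoldiProj T b i x⟫_𝕜 = 0 := by
      rw [← ih, ← inner_arnoldiProj_left, arnoldiProj_apply_arnoldiVec_self, inner_zero_left]
    rw [arnoldiProj_succ, add_apply, rankOne_apply, horth, zero_smul, add_zero, ih]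

theorem arnoldiProj_succ_apply_arnoldiVec (j : ℕ) :
    arnoldiProj T b (j + 1) (arnoldiVec T b j) = arnoldiVec T b j := by
  rw [arnoldiProj_succ, add_apply, arnoldiProj_apply_arnoldiVec_self, zero_add, rankOne_apply,
    inner_arnoldiVec_self_smul]

theorem arnoldiProj_apply_arnoldiVec_of_lt {i j : ℕ} (hij : i < j) :
    arnoldiProj T b j (arnoldiVec T b i) = arnoldiVec T b i := by
  rw [← arnoldiProj_succ_apply_arnoldiVec, arnoldiProj_apply_arnoldiProj T b hij]

theorem inner_arnoldiVec_of_ne {i j : ℕ} (hij : i ≠ j) :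
    ⟪arnoldiVec T b i, arnoldiVec T b j⟫_𝕜 = 0 := by
  wlog h : i < j generalizing i j
  · exact inner_eq_zero_symm.1 (this hij.symm (by omega))
  rw [← arnoldiProj_apply_arnoldiVec_of_lt T b h, inner_arnoldiProj_left,
    arnoldiProj_apply_arnoldiVec_self, inner_zero_right]

theorem arnoldiProj_apply_apply_arnoldiVec {i j : ℕ} (hij : i + 2 ≤ j) :
    arnoldiProj T b j (T (arnoldiVec T b i)) = T (arnoldiVec T b i) := by
  rw [apply_arnoldiVec_eq, map_add, map_smul, arnoldiProj_apply_arnoldiProj T b (by omega),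
    arnoldiProj_apply_arnoldiVec_of_lt T b (by omega)]

theorem inner_arnoldiVec_apply_of_lt {i j : ℕ} (hij : j + 1 < i) :
    ⟪arnoldiVec T b i, T (arnoldiVec T b j)⟫_𝕜 = 0 := by
  rw [← arnoldiProj_apply_apply_arnoldiVec T b hij, ← inner_arnoldiProj_left,
    arnoldiProj_apply_arnoldiVec_self, inner_zero_left]

theorem inner_arnoldiVec_succ_apply (j : ℕ) :
    ⟪arnoldiVec T b (j + 1), T (arnoldiVec T b j)⟫_𝕜 = ‖arnoldiResidual T b (j + 1)‖ := by
  rw [apply_arnoldiVec_eq, inner_add_right, ← inner_arnoldiProj_left,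
    arnoldiProj_apply_arnoldiVec_self, inner_zero_left, zero_add, norm_smul_arnoldiVec, arnoldiVec,
    inner_smul_left, inner_self_eq_norm_sq_to_K, map_inv₀, RCLike.conj_ofReal, sq, ← mul_assoc,
    inv_mul_mul_self]

theorem norm_sub_arnoldiProj_apply_sq (j : ℕ) (x : E) : ‖x - arnoldiProj T b j x‖ ^ 2 =
    ‖x‖ ^ 2 - ∑ i ∈ Finset.range j, ‖⟪arnoldiVec T b i, x⟫_𝕜‖ ^ 2 := by
  have hself : ‖arnoldiProj T b j x‖ ^ 2 = RCLike.re ⟪x, arnoldiProj T b j x⟫_𝕜 := by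
    rw [← inner_self_eq_norm_sq (𝕜 := 𝕜), inner_arnoldiProj_left,
      arnoldiProj_apply_arnoldiProj T b le_rfl]
  have hsum : RCLike.re ⟪x, arnoldiProj T b j x⟫_𝕜 =
      ∑ i ∈ Finset.range j, ‖⟪arnoldiVec T b i, x⟫_𝕜‖ ^ 2 := by
    rw [arnoldiProj_apply, inner_sum, map_sum]
    refine Finset.sum_congr rfl fun i _ => ?_
    rw [inner_smul_right, inner_mul_symm_re_eq_norm, norm_mul, norm_inner_symm x, sq]
  rw [norm_sub_sq (𝕜 := 𝕜), hself, hsum]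
  ring

theorem norm_arnoldiResidual_succ_sq (j : ℕ) : ‖arnoldiResidual T b (j + 1)‖ ^ 2 =
    ‖T (arnoldiVec T b j)‖ ^ 2 -
      ∑ i ∈ Finset.range (j + 1), ‖⟪arnoldiVec T b i, T (arnoldiVec T b j)⟫_𝕜‖ ^ 2 :=
  norm_sub_arnoldiProj_apply_sq T b (j + 1) _

theorem arnoldiProj_apply_pow_apply {m j : ℕ} (hmj : m < j) :
    arnoldiProj T b j ((T ^ m) (arnoldiVec T b 0)) = (T ^ m) (arnoldiVec T b 0) := by
  induction m generalizing j with
  | zero => exact arnoldiProj_apply_arnoldiVec_of_lt T b hmj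
  | succ m ih =>
    rw [pow_succ', mul_apply_eq_comp, ← ih m.lt_succ_self, arnoldiProj_apply _ _ (m + 1)]
    simp only [map_sum, map_smul]
    refine Finset.sum_congr rfl fun l hl => ?_
    rw [arnoldiProj_apply_apply_arnoldiVec T b (by have := Finset.mem_range.1 hl; omega)]

theorem pow_apply_arnoldiVec_zero_eq_sum {m j : ℕ} (hmj : m < j) : (T ^ m) (arnoldiVec T b 0) =
    ∑ l ∈ Finset.range j,
      ⟪arnoldiVec T b l, (T ^ m) (arnoldiVec T b 0)⟫_𝕜 • arnoldiVec T b l := by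
  rw [← arnoldiProj_apply, arnoldiProj_apply_pow_apply T b hmj]

variable {T} in
theorem arnoldiState_congr {S : E →L[𝕜] E} {j : ℕ}
    (h : S * arnoldiProj T b j = T * arnoldiProj T b j) {i : ℕ} (hij : i ≤ j) :
    arnoldiState S b i = arnoldiState T b i := by
  induction i with
  | zero => rfl
  | succ i ih =>
    have happly : S (arnoldiVec T b i) = T (arnoldiVec T b i) := by
      rw [← arnoldiProj_apply_arnoldiVec_of_lt T b hij]
      exact DFunLike.congr_fun h _
    have hstate := ih (by omega)
    have hvec : arnoldiVec S b i = arnoldiVec T b i := by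
      rw [arnoldiVec, arnoldiVec, arnoldiResidual, arnoldiResidual, hstate]
    have hproj : arnoldiProj S b (i + 1) = arnoldiProj T b (i + 1) := by
      rw [arnoldiProj_succ, arnoldiProj_succ, arnoldiProj, arnoldiProj, hstate, hvec]
    have hresidual : arnoldiResidual S b (i + 1) = arnoldiResidual T b (i + 1) := by
      rw [arnoldiResidual_succ, arnoldiResidual_succ, hproj, hvec, happly]
    exact Prod.ext hproj hresidual

end Arnoldi

section MeasurableArnoldi

variable {𝕜 E : Type*} [RCLike 𝕜] [NormedAddCommGroup E] [InnerProductSpace 𝕜 E]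
  [MeasurableSpace E] [BorelSpace E] [SecondCountableTopology E]
  [SecondCountableTopology (E →L[𝕜] E)]

theorem measurable_arnoldiState (j : ℕ) :
    Measurable fun p : (E →L[𝕜] E) × E => arnoldiState p.1 p.2 j := by
  induction j with
  | zero => exact measurable_const.prodMk measurable_snd
  | succ j ih =>
    have hvec : Measurable fun p : (E →L[𝕜] E) × E => arnoldiVec p.1 p.2 j :=
      (RCLike.measurable_ofReal.comp ih.snd.norm).inv.smul ih.snd
    have hrankOne : Continuous fun v : E => InnerProductSpace.rankOne 𝕜 v v :=
      ((ContinuousLinearMap.smulRightL 𝕜 E E).continuous.comp (innerSL 𝕜).continuous).clm_apply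
        continuous_id
    have hproj : Measurable fun p : (E →L[𝕜] E) × E => arnoldiProj p.1 p.2 (j + 1) :=
      ih.fst.add (hrankOne.measurable.comp hvec)
    have happly : Measurable fun q : (E →L[𝕜] E) × E => q.1 q.2 :=
      (continuous_fst.clm_apply continuous_snd).measurable
    have hTv := happly.comp (measurable_fst.prodMk hvec)
    exact hproj.prodMk (hTv.sub (happly.comp (hproj.prodMk hTv)))

theorem measurable_arnoldiProj (j : ℕ) :
    Measurable fun p : (E →L[𝕜] E) × E => arnoldiProj p.1 p.2 j :=
  (measurable_arnoldiState j).fst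

theorem measurable_arnoldiVec (j : ℕ) :
    Measurable fun p : (E →L[𝕜] E) × E => arnoldiVec p.1 p.2 j :=
  (RCLike.measurable_ofReal.comp (measurable_arnoldiState j).snd.norm).inv.smul
    (measurable_arnoldiState j).snd

theorem measurable_apply_arnoldiVec (j : ℕ) :
    Measurable fun p : (E →L[𝕜] E) × E => p.1 (arnoldiVec p.1 p.2 j) :=
  (continuous_fst.clm_apply continuous_snd).measurable.comp
    (measurable_fst.prodMk (measurable_arnoldiVec j))

theorem measurable_inner_arnoldiVec_apply (i j : ℕ) :
    Measurable fun p : (E →L[𝕜] E) × E =>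
      ⟪arnoldiVec p.1 p.2 i, p.1 (arnoldiVec p.1 p.2 j)⟫_𝕜 :=
  (measurable_arnoldiVec i).inner (measurable_apply_arnoldiVec j)

theorem measurable_norm_apply_arnoldiVec_sq_sub_sq (j : ℕ) :
    Measurable fun p : (E →L[𝕜] E) × E =>
      ‖p.1 (arnoldiVec p.1 p.2 j)‖ ^ 2 - ‖arnoldiVec p.1 p.2 j‖ ^ 2 :=
  ((measurable_apply_arnoldiVec j).norm.pow_const 2).sub
    ((measurable_arnoldiVec j).norm.pow_const 2)

theorem measurable_lintegral_resample {μ : Measure (E →L[𝕜] E)} [SFinite μ]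
    (b : E) (j : ℕ) {f : (E →L[𝕜] E) → ℝ≥0∞} (hf : Measurable f) :
    Measurable fun T => ∫⁻ S, f (T * arnoldiProj T b j + S * (1 - arnoldiProj T b j)) ∂μ := by
  have hP : Measurable fun T : E →L[𝕜] E => arnoldiProj T b j :=
    (measurable_arnoldiProj j).comp measurable_prodMk_right
  have hfst : Measurable fun T : (E →L[𝕜] E) × (E →L[𝕜] E) => arnoldiProj T.1 b j :=
    hP.comp measurable_fst
  exact (hf.comp ((measurable_fst.mul hfst).add
    (measurable_snd.mul (measurable_const.sub hfst)))).lintegral_prod_right'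

end MeasurableArnoldi

section Resampling

variable {𝕜 E : Type*} [RCLike 𝕜] [NormedAddCommGroup E] [InnerProductSpace 𝕜 E] [CompleteSpace E]

theorem arnoldiState_resample (T S : E →L[𝕜] E) (b : E) {i j : ℕ} (hij : i ≤ j) :
    arnoldiState (T * arnoldiProj T b j + S * (1 - arnoldiProj T b j)) b i =
      arnoldiState T b i := by
  have hP := isStarProjection_arnoldiProj T b j
  refine arnoldiState_congr b ?_ hij
  rw [add_mul, mul_assoc, mul_assoc, hP.isIdempotentElem.eq, hP.one_sub_mul_self, mul_zero,
    add_zero]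

theorem arnoldiVec_resample (T S : E →L[𝕜] E) (b : E) {i j : ℕ} (hij : i ≤ j) :
    arnoldiVec (T * arnoldiProj T b j + S * (1 - arnoldiProj T b j)) b i = arnoldiVec T b i := by
  simp only [arnoldiVec, arnoldiResidual, arnoldiState_resample T S b hij]

theorem arnoldiProj_succ_resample (T S : E →L[𝕜] E) (b : E) (j : ℕ) :
    arnoldiProj (T * arnoldiProj T b j + S * (1 - arnoldiProj T b j)) b (j + 1) =
      arnoldiProj T b (j + 1) := by
  rw [arnoldiProj_succ, arnoldiProj_succ, arnoldiVec_resample T S b le_rfl]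
  exact congrArg (·.1 + _) (arnoldiState_resample T S b le_rfl)

theorem resample_arnoldiProj_succ (T S U : E →L[𝕜] E) (b : E) (j : ℕ) :
    (T * arnoldiProj T b j + S * (1 - arnoldiProj T b j)) * arnoldiProj T b (j + 1) +
        U * (1 - arnoldiProj T b (j + 1)) =
      T * arnoldiProj T b j + (S * arnoldiProj T b (j + 1) + U * (1 - arnoldiProj T b (j + 1))) *
        (1 - arnoldiProj T b j) := by
  have hQP : arnoldiProj T b (j + 1) * arnoldiProj T b j = arnoldiProj T b j :=
    ContinuousLinearMap.ext (arnoldiProj_apply_arnoldiProj T b j.le_succ)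
  have hPQ : arnoldiProj T b j * arnoldiProj T b (j + 1) = arnoldiProj T b j := by
    simpa only [star_mul, (isStarProjection_arnoldiProj T b _).isSelfAdjoint.star_eq]
      using congrArg star hQP
  simp only [mul_sub, sub_mul, add_mul, mul_assoc, hQP, hPQ, mul_one]
  abel

/-- The law `μ` of a random operator `T` is invariant under resampling if it remains the same when
`T` is replaced by an independent copy of itself on the kernel of an orthogonal projection. -/
def IsResampleInvariant (μ : Measure (E →L[𝕜] E)) : Prop :=
  ∀ Q : E →L[𝕜] E, IsStarProjection Q →
    (μ.prod μ).map (fun T => T.1 * Q + T.2 * (1 - Q)) = μ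

variable [SecondCountableTopology (E →L[𝕜] E)] {μ : Measure (E →L[𝕜] E)} [SFinite μ]

theorem IsResampleInvariant.lintegral_eq (hμ : IsResampleInvariant μ) {Q : E →L[𝕜] E}
    (hQ : IsStarProjection Q) {f : (E →L[𝕜] E) → ℝ≥0∞} (hf : Measurable f) :
    ∫⁻ T, ∫⁻ S, f (T * Q + S * (1 - Q)) ∂μ ∂μ = ∫⁻ T, f T ∂μ := by
  have hmeas : Measurable fun T : (E →L[𝕜] E) × (E →L[𝕜] E) => T.1 * Q + T.2 * (1 - Q) := by
    fun_prop
  rw [← lintegral_prod (fun T => f (T.1 * Q + T.2 * (1 - Q))) (hf.comp hmeas).aemeasurable,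
    ← lintegral_map hf hmeas, hμ Q hQ]

variable [MeasurableSpace E] [BorelSpace E] [SecondCountableTopology E]

/-- Resampling with the projection of step `j + 1` after resampling with that of step `j` amounts
to one resampling with the latter, by an operator which is itself resampled. -/
theorem IsResampleInvariant.lintegral_arnoldiProj (hμ : IsResampleInvariant μ) (b : E) (j : ℕ)
    {f : (E →L[𝕜] E) → ℝ≥0∞} (hf : Measurable f) :
    ∫⁻ T, ∫⁻ S, f (T * arnoldiProj T b j + S * (1 - arnoldiProj T b j)) ∂μ ∂μ =
      ∫⁻ T, f T ∂μ := by
  induction j generalizing f with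
  | zero => exact hμ.lintegral_eq (IsStarProjection.zero _) hf
  | succ j ih =>
    rw [← ih (measurable_lintegral_resample b (j + 1) hf), ← ih hf]
    refine lintegral_congr fun T => ?_
    simp only [arnoldiProj_succ_resample, resample_arnoldiProj_succ]
    exact hμ.lintegral_eq (isStarProjection_arnoldiProj T b (j + 1))
      (f := fun S => f (T * arnoldiProj T b j + S * (1 - arnoldiProj T b j)))
      (hf.comp (by fun_prop))

theorem IsResampleInvariant.lintegral_arnoldiVec (hμ : IsResampleInvariant μ) (b : E) {i j : ℕ}
    (hij : i ≤ j) {f : E × E × E → ℝ≥0∞} (hf : Measurable f) :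
    ∫⁻ T, f (arnoldiVec T b i, arnoldiVec T b j, T (arnoldiVec T b j)) ∂μ =
      ∫⁻ T, ∫⁻ S, f (arnoldiVec T b i, arnoldiVec T b j, S (arnoldiVec T b j)) ∂μ ∂μ := by
  have hmeas : Measurable fun T : E →L[𝕜] E =>
      f (arnoldiVec T b i, arnoldiVec T b j, T (arnoldiVec T b j)) :=
    hf.comp <| ((measurable_arnoldiVec i).prodMk ((measurable_arnoldiVec j).prodMk
      (measurable_apply_arnoldiVec j))).comp measurable_prodMk_right
  rw [← hμ.lintegral_arnoldiProj b j hmeas]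
  refine lintegral_congr fun T => lintegral_congr fun S => ?_
  have happly : (T * arnoldiProj T b j + S * (1 - arnoldiProj T b j)) (arnoldiVec T b j) =
      S (arnoldiVec T b j) := by
    simp [arnoldiProj_apply_arnoldiVec_self]
  rw [arnoldiVec_resample T S b hij, arnoldiVec_resample T S b le_rfl, happly]

end Resampling

section StdGaussian

theorem enorm_sq_eq_ofReal_norm_sq {E : Type*} [SeminormedAddGroup E] (x : E) :
    ‖x‖ₑ ^ 2 = ENNReal.ofReal (‖x‖ ^ 2) := by
  rw [ENNReal.ofReal_pow (norm_nonneg x), ofReal_norm]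

variable {E F H : Type*} [NormedAddCommGroup E] [InnerProductSpace ℝ E] [MeasurableSpace E]
  [NormedAddCommGroup F] [InnerProductSpace ℝ F] [MeasurableSpace F] [BorelSpace F]
  [NormedAddCommGroup H] [InnerProductSpace ℝ H] [MeasurableSpace H] [BorelSpace H]

theorem charFun_map_of_inner_eq {μ : Measure E} {K : E → H} (hK : Measurable K) {s : E} {t : H}
    (h : ∀ x, ⟪K x, t⟫_ℝ = ⟪x, s⟫_ℝ) : charFun (μ.map K) t = charFun μ s := by
  rw [charFun_apply, charFun_apply, integral_map hK.aemeasurable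
    (Measurable.aestronglyMeasurable (by fun_prop))]
  simp only [h]

variable [BorelSpace E] [FiniteDimensional ℝ E] [FiniteDimensional ℝ F] [FiniteDimensional ℝ H]

theorem map_stdGaussian_eq_map_smul {K : E → H} (hK : Measurable K) {K' : H → E}
    (hadj : ∀ x t, ⟪K x, t⟫_ℝ = ⟪x, K' t⟫_ℝ) (c : ℝ) (hnorm : ∀ t, ‖K' t‖ = c * ‖t‖) :
    (stdGaussian E).map K = (stdGaussian H).map (c • ·) := by
  have := Measure.isProbabilityMeasure_map (μ := stdGaussian E) hK.aemeasurable
  have := Measure.isProbabilityMeasure_map (μ := stdGaussian H)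
    (f := (c • ·)) (Measurable.aemeasurable (by fun_prop))
  refine Measure.ext_of_charFun (funext fun t => ?_)
  rw [charFun_map_of_inner_eq hK (hadj · t), charFun_map_smul, charFun_stdGaussian,
    charFun_stdGaussian, hnorm, norm_smul, ← Complex.ofReal_pow, ← Complex.ofReal_pow, mul_pow,
    mul_pow, Real.norm_eq_abs, sq_abs]

theorem map_add_stdGaussian_prod {K : E → H} {L : F → H} (hK : Measurable K) (hL : Measurable L)
    {K' : H → E} {L' : H → F} (hKadj : ∀ x t, ⟪K x, t⟫_ℝ = ⟪x, K' t⟫_ℝ)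
    (hLadj : ∀ x t, ⟪L x, t⟫_ℝ = ⟪x, L' t⟫_ℝ)
    (hnorm : ∀ t, ‖K' t‖ ^ 2 + ‖L' t‖ ^ 2 = ‖t‖ ^ 2) :
    ((stdGaussian E).prod (stdGaussian F)).map (fun p => K p.1 + L p.2) = stdGaussian H := by
  have hKL : Measurable (Prod.map K L) := hK.prodMap hL
  have hadd : Measurable fun p : H × H => p.1 + p.2 := by fun_prop
  have := Measure.isProbabilityMeasure_map (μ := stdGaussian E) hK.aemeasurable
  have := Measure.isProbabilityMeasure_map (μ := stdGaussian F) hL.aemeasurable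
  have := Measure.isProbabilityMeasure_map (μ := (stdGaussian E).prod (stdGaussian F))
    (hadd.comp hKL).aemeasurable
  have hconv : ((stdGaussian E).prod (stdGaussian F)).map (fun p => K p.1 + L p.2) =
      (stdGaussian E).map K ∗ (stdGaussian F).map L := by
    rw [Measure.conv, Measure.map_prod_map _ _ hK hL, Measure.map_map hadd hKL]
    rfl
  refine Measure.ext_of_charFun (funext fun t => ?_)
  rw [hconv, charFun_conv, charFun_map_of_inner_eq hK (hKadj · t),
    charFun_map_of_inner_eq hL (hLadj · t), charFun_stdGaussian, charFun_stdGaussian,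
    charFun_stdGaussian, ← Complex.exp_add, ← add_div, ← neg_add]
  norm_cast
  rw [hnorm]

theorem lintegral_enorm_inner_sq_stdGaussian (v : E) :
    ∫⁻ x, ‖⟪v, x⟫_ℝ‖ₑ ^ 2 ∂stdGaussian E = ‖v‖ₑ ^ 2 := by
  have hvar := ofReal_variance (IsGaussian.memLp_dual (stdGaussian E) (innerSL ℝ v) 2 (by simp))
  rw [variance_dual_stdGaussian, innerSL_apply_norm, evariance,
    integral_strongDual_stdGaussian] at hvar
  simp only [sub_zero, innerSL_apply_apply] at hvar
  rw [← hvar, enorm_sq_eq_ofReal_norm_sq]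

theorem memLp_norm_sq_of_isGaussian (μ : Measure E) [IsGaussian μ] :
    MemLp (fun x => ‖x‖ ^ 2) 2 μ := by
  have h := (IsGaussian.memLp_id μ 4 (by simp)).norm_rpow_div 2
  have hexp : (4 : ℝ≥0∞) / 2 = 2 := by
    rw [← ENNReal.toReal_eq_toReal_iff' (by finiteness) (by finiteness), ENNReal.toReal_div]
    norm_num
  simpa [hexp] using h

theorem integral_norm_sq_stdGaussian :
    ∫ x, ‖x‖ ^ 2 ∂stdGaussian E = Module.finrank ℝ E := by
  let e := stdOrthonormalBasis ℝ E
  have hsq (x : E) : ‖x‖ ^ 2 = ∑ i, innerSL ℝ (e i) x ^ 2 := by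
    simp only [innerSL_apply_apply, ← e.sum_sq_norm_inner_right x, Real.norm_eq_abs, sq_abs]
  have hmem (i) : MemLp (innerSL ℝ (e i)) 2 (stdGaussian E) :=
    IsGaussian.memLp_dual _ _ 2 (by simp)
  have hone (i) : ∫ x, innerSL ℝ (e i) x ^ 2 ∂stdGaussian E = 1 := by
    have hvar := variance_of_integral_eq_zero (hmem i).aemeasurable
      (integral_strongDual_stdGaussian _)
    rw [← hvar, variance_dual_stdGaussian, innerSL_apply_norm, e.norm_eq_one, one_pow]
  simp only [hsq]
  rw [integral_finsetSum _ fun i _ => (hmem i).integrable_sq]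
  simp only [hone, Finset.sum_const, Finset.card_univ, Fintype.card_fin, nsmul_one]

theorem variance_norm_sq_stdGaussian :
    Var[fun x => ‖x‖ ^ 2; stdGaussian E] =
      Module.finrank ℝ E * Var[fun x => x ^ 2; gaussianReal 0 1] := by
  have hnorm (x : Fin (Module.finrank ℝ E) → ℝ) :
      ‖∑ i, x i • stdOrthonormalBasis ℝ E i‖ ^ 2 = ∑ i, x i ^ 2 := by
    rw [← real_inner_self_eq_norm_sq, (stdOrthonormalBasis ℝ E).orthonormal.inner_sum]
    simp only [sq, conj_trivial]
  have hsq : MemLp (fun x : ℝ => x ^ 2) 2 (gaussianReal 0 1) := by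
    simpa only [Real.norm_eq_abs, sq_abs] using memLp_norm_sq_of_isGaussian (gaussianReal 0 1)
  have hpi := variance_sum_pi (ι := Fin (Module.finrank ℝ E)) fun _ => hsq
  rw [stdGaussian, variance_map (Measurable.aemeasurable (by fun_prop))
    (Measurable.aemeasurable (by fun_prop))]
  simp only [Function.comp_def, hnorm]
  convert hpi using 2
  · exact (Finset.sum_fn _ _).symm
  · rw [Finset.sum_const, Finset.card_univ, Fintype.card_fin, nsmul_eq_mul]

theorem lintegral_enorm_norm_sq_sub_finrank_sq_stdGaussian :
    ∫⁻ x, ‖‖x‖ ^ 2 - Module.finrank ℝ E‖ₑ ^ 2 ∂stdGaussian E =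
      ENNReal.ofReal (Module.finrank ℝ E * Var[fun x => x ^ 2; gaussianReal 0 1]) := by
  rw [← variance_norm_sq_stdGaussian, ofReal_variance (memLp_norm_sq_of_isGaussian _), evariance,
    integral_norm_sq_stdGaussian]

end StdGaussian

section GinibreLaw

open InnerProductSpace

theorem norm_sq_add_norm_one_sub_sq_of_isStarProjection {𝕜 E : Type*} [RCLike 𝕜]
    [NormedAddCommGroup E] [InnerProductSpace 𝕜 E] [CompleteSpace E] {Q : E →L[𝕜] E}
    (hQ : IsStarProjection Q) (x : E) : ‖Q x‖ ^ 2 + ‖(1 - Q) x‖ ^ 2 = ‖x‖ ^ 2 := by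
  have horth : ⟪Q x, (1 - Q) x⟫_𝕜 = 0 := by
    rw [hQ.isSelfAdjoint.isSymmetric.apply_clm, ← mul_apply_eq_comp, hQ.mul_one_sub_self,
      zero_apply, inner_zero_right]
  have hadd : Q x + (1 - Q) x = x := by rw [← add_apply, add_sub_cancel]; rfl
  simpa only [hadd, sq] using (norm_add_sq_eq_norm_sq_add_norm_sq_of_inner_eq_zero _ _ horth).symm

variable {n : Type*} [Fintype n]

theorem real_inner_eq_re_inner_euclideanSpace (x y : EuclideanSpace ℂ n) :
    ⟪x, y⟫_ℝ = RCLike.re ⟪x, y⟫_ℂ := by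
  simp only [PiLp.inner_apply, map_sum]
  rfl

theorem lintegral_enorm_inner_sq_stdGaussian_euclideanSpace (x : EuclideanSpace ℂ n) :
    ∫⁻ h, ‖⟪x, h⟫_ℂ‖ₑ ^ 2 ∂stdGaussian (EuclideanSpace ℂ n) = 2 * ‖x‖ₑ ^ 2 := by
  have hsplit (h : EuclideanSpace ℂ n) :
      ‖⟪x, h⟫_ℂ‖ₑ ^ 2 = ‖⟪x, h⟫_ℝ‖ₑ ^ 2 + ‖⟪Complex.I • x, h⟫_ℝ‖ₑ ^ 2 := by
    rw [real_inner_eq_re_inner_euclideanSpace, real_inner_eq_re_inner_euclideanSpace,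
      inner_smul_left, enorm_sq_eq_ofReal_norm_sq, enorm_sq_eq_ofReal_norm_sq,
      enorm_sq_eq_ofReal_norm_sq, ← ENNReal.ofReal_add (by positivity) (by positivity),
      ← RCLike.normSq_eq_def', RCLike.normSq_apply]
    simp [sq]
  simp only [hsplit]
  rw [lintegral_add_left (by fun_prop), lintegral_enorm_inner_sq_stdGaussian,
    lintegral_enorm_inner_sq_stdGaussian, enorm_sq_eq_ofReal_norm_sq (Complex.I • x), norm_smul,
    Complex.norm_I, one_mul, ← enorm_sq_eq_ofReal_norm_sq, two_mul]

variable [DecidableEq n]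

/-- The operator whose matrix has the rows `star (a i)`. The rows are conjugated in order that the
`i`-th coordinate of its value at `x` is the inner product of `a i` and `x`. -/
noncomputable def ofRows (a : PiLp 2 fun _ : n => EuclideanSpace ℂ n) :
    EuclideanSpace ℂ n →L[ℂ] EuclideanSpace ℂ n :=
  ∑ i, rankOne ℂ (EuclideanSpace.single i 1) (a i)

theorem ofRows_apply (a : PiLp 2 fun _ : n => EuclideanSpace ℂ n) (x : EuclideanSpace ℂ n) (i : n) :
    ofRows a x i = ⟪a i, x⟫_ℂ := by
  simp [ofRows, rankOne_apply, Pi.single_apply]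

theorem ofRows_add (a b : PiLp 2 fun _ : n => EuclideanSpace ℂ n) :
    ofRows (a + b) = ofRows a + ofRows b := by
  simp only [ofRows, PiLp.add_apply, map_add, Finset.sum_add_distrib]

theorem ofRows_mul {Q : EuclideanSpace ℂ n →L[ℂ] EuclideanSpace ℂ n} (hQ : IsStarProjection Q)
    (a : PiLp 2 fun _ : n => EuclideanSpace ℂ n) :
    ofRows a * Q = ofRows (WithLp.toLp 2 fun i => Q (a i)) := by
  ext x i
  rw [mul_apply_eq_comp, ofRows_apply, ofRows_apply]
  exact (hQ.isSelfAdjoint.isSymmetric _ _).symm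

theorem continuous_ofRows : Continuous (ofRows (n := n)) := by
  unfold ofRows
  fun_prop

variable (n) in
/-- The law of the operator on `EuclideanSpace ℂ n` given by a complex Ginibre matrix. -/
noncomputable def ginibreLaw : Measure (EuclideanSpace ℂ n →L[ℂ] EuclideanSpace ℂ n) :=
  (stdGaussian (PiLp 2 fun _ : n => EuclideanSpace ℂ n)).map
    fun a => ((√(2 * Fintype.card n) : ℝ) : ℂ)⁻¹ • ofRows a

theorem measurable_smul_ofRows (c : ℂ) : Measurable fun a => c • ofRows (n := n) a :=
  (continuous_ofRows.const_smul c).measurable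

instance : IsProbabilityMeasure (ginibreLaw n) :=
  Measure.isProbabilityMeasure_map (measurable_smul_ofRows _).aemeasurable

-- A shortcut: on spaces of operators the instance search for `SFinite` runs into a timeout.
instance : SFinite (ginibreLaw n) :=
  @instSFiniteOfSigmaFinite _ _ _ (IsFiniteMeasure.toSigmaFinite _)

theorem isResampleInvariant_ginibreLaw : IsResampleInvariant (ginibreLaw n) := by
  intro Q hQ
  let applyRows (R : EuclideanSpace ℂ n →L[ℂ] EuclideanSpace ℂ n)
      (a : PiLp 2 fun _ : n => EuclideanSpace ℂ n) : PiLp 2 fun _ : n => EuclideanSpace ℂ n :=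
    WithLp.toLp 2 fun i => R (a i)
  have hmeas (R) : Measurable (applyRows R) := Continuous.measurable (by fun_prop)
  have hadj {R} (hR : IsStarProjection R) (a t) :
      ⟪applyRows R a, t⟫_ℝ = ⟪a, applyRows R t⟫_ℝ := by
    simp only [PiLp.inner_apply (𝕜 := ℝ) (f := fun _ : n => EuclideanSpace ℂ n),
      real_inner_eq_re_inner_euclideanSpace]
    exact Finset.sum_congr rfl fun i _ => congrArg RCLike.re (hR.isSelfAdjoint.isSymmetric _ _)
  have hnorm (t) : ‖applyRows Q t‖ ^ 2 + ‖applyRows (1 - Q) t‖ ^ 2 = ‖t‖ ^ 2 := by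
    simp only [PiLp.norm_sq_eq_of_L2 fun _ : n => EuclideanSpace ℂ n, ← Finset.sum_add_distrib]
    exact Finset.sum_congr rfl fun i _ => norm_sq_add_norm_one_sub_sq_of_isStarProjection hQ (t i)
  have hrows := map_add_stdGaussian_prod (hmeas Q) (hmeas (1 - Q)) (hadj hQ) (hadj hQ.one_sub) hnorm
  have hop := measurable_smul_ofRows (n := n) ((√(2 * Fintype.card n) : ℝ) : ℂ)⁻¹
  rw [ginibreLaw, Measure.map_prod_map _ _ hop hop, Measure.map_map (by fun_prop)
    (hop.prodMap hop)]
  conv_rhs => rw [← hrows, Measure.map_map hop (by fun_prop)]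
  refine congrArg (Measure.map · _) (funext fun a => ?_)
  simp only [Function.comp_apply, Prod.map, smul_mul_assoc, ofRows_mul hQ, ofRows_mul hQ.one_sub,
    ofRows_add, smul_add, applyRows]

theorem map_apply_ginibreLaw (y : EuclideanSpace ℂ n) :
    (ginibreLaw n).map (fun T => T y) = (stdGaussian (EuclideanSpace ℂ n)).map
      ((‖y‖ / √(2 * Fintype.card n)) • ·) := by
  have hrows : (stdGaussian (PiLp 2 fun _ : n => EuclideanSpace ℂ n)).map (fun a => ofRows a y) =
      (stdGaussian (EuclideanSpace ℂ n)).map (‖y‖ • ·) := by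
    refine map_stdGaussian_eq_map_smul (continuous_ofRows.clm_apply continuous_const).measurable
      (K' := fun t => WithLp.toLp 2 fun i => star (t i) • y) (fun a t => ?_) ‖y‖ fun t => ?_
    · simp only [PiLp.inner_apply (𝕜 := ℝ) (f := fun _ : n => EuclideanSpace ℂ n),
        real_inner_eq_re_inner_euclideanSpace, PiLp.inner_apply (𝕜 := ℂ) (ofRows a y) t, map_sum,
        ofRows_apply, inner_smul_right, RCLike.inner_apply, inner_conj_symm]
      refine Finset.sum_congr rfl fun i _ => ?_
      rw [← RCLike.conj_re, map_mul, inner_conj_symm, starRingEnd_apply]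
    · rw [← sq_eq_sq₀ (norm_nonneg _) (by positivity), mul_pow,
        PiLp.norm_sq_eq_of_L2 fun _ : n => EuclideanSpace ℂ n, EuclideanSpace.norm_sq_eq t,
        Finset.mul_sum]
      simp only [norm_smul, norm_star, mul_pow, mul_comm]
  have hsmul (c : ℝ) : Measurable fun h : EuclideanSpace ℂ n => c • h := by fun_prop
  calc (ginibreLaw n).map (fun T => T y)
      = ((stdGaussian (PiLp 2 fun _ : n => EuclideanSpace ℂ n)).map (fun a => ofRows a y)).map
          ((√(2 * Fintype.card n))⁻¹ • ·) := by
        rw [ginibreLaw, Measure.map_map (by fun_prop) (measurable_smul_ofRows _),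
          Measure.map_map (hsmul _) (continuous_ofRows.clm_apply continuous_const).measurable]
        refine congrArg (Measure.map · _) (funext fun a => ?_)
        simp only [Function.comp_apply, ← Complex.ofReal_inv]
        rfl
    _ = (stdGaussian (EuclideanSpace ℂ n)).map ((‖y‖ / √(2 * Fintype.card n)) • ·) := by
        rw [hrows, Measure.map_map (hsmul _) (hsmul _)]
        simp only [Function.comp_def, smul_smul, div_eq_inv_mul]

theorem lintegral_apply_ginibreLaw {f : EuclideanSpace ℂ n → ℝ≥0∞} (hf : Measurable f)
    (y : EuclideanSpace ℂ n) : ∫⁻ T, f (T y) ∂ginibreLaw n =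
      ∫⁻ h, f ((‖y‖ / √(2 * Fintype.card n)) • h) ∂stdGaussian (EuclideanSpace ℂ n) := by
  have h := congrArg (fun μ => ∫⁻ x, f x ∂μ) (map_apply_ginibreLaw y)
  rwa [lintegral_map hf (by fun_prop), lintegral_map hf (by fun_prop)] at h

theorem lintegral_enorm_inner_apply_sq_ginibreLaw (x y : EuclideanSpace ℂ n) :
    ∫⁻ T, ‖⟪x, T y⟫_ℂ‖ₑ ^ 2 ∂ginibreLaw n =
      ENNReal.ofReal (‖x‖ ^ 2 * ‖y‖ ^ 2 / Fintype.card n) := by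
  rw [lintegral_apply_ginibreLaw (f := fun h => ‖⟪x, h⟫_ℂ‖ₑ ^ 2) (by fun_prop)]
  simp only [inner_smul_right_eq_smul, enorm_smul, mul_pow]
  rw [lintegral_const_mul _ (by fun_prop), lintegral_enorm_inner_sq_stdGaussian_euclideanSpace,
    enorm_sq_eq_ofReal_norm_sq, enorm_sq_eq_ofReal_norm_sq, two_mul (ENNReal.ofReal _),
    ← ENNReal.ofReal_add (sq_nonneg _) (sq_nonneg _), ← ENNReal.ofReal_mul (sq_nonneg _)]
  congr 1
  rw [Real.norm_eq_abs, sq_abs, div_pow, Real.sq_sqrt (by positivity)]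
  ring

theorem lintegral_enorm_norm_apply_sq_sub_sq_ginibreLaw [Nonempty n] (y : EuclideanSpace ℂ n) :
    ∫⁻ T, ‖‖T y‖ ^ 2 - ‖y‖ ^ 2‖ₑ ^ 2 ∂ginibreLaw n =
      ENNReal.ofReal (‖y‖ ^ 4 * Var[fun x => x ^ 2; gaussianReal 0 1] / (2 * Fintype.card n)) := by
  have hrank : Module.finrank ℝ (EuclideanSpace ℂ n) = 2 * Fintype.card n := by
    rw [finrank_real_of_complex, finrank_euclideanSpace]
  have : (2 * Fintype.card n : ℝ) ≠ 0 := by positivity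
  have hfactor (h : EuclideanSpace ℂ n) : ‖(‖y‖ / √(2 * Fintype.card n)) • h‖ ^ 2 - ‖y‖ ^ 2 =
      ‖y‖ ^ 2 / (2 * Fintype.card n) * (‖h‖ ^ 2 - Module.finrank ℝ (EuclideanSpace ℂ n)) := by
    rw [norm_smul, mul_pow, Real.norm_eq_abs, sq_abs, div_pow, Real.sq_sqrt (by positivity), hrank]
    push_cast
    field_simp
  rw [lintegral_apply_ginibreLaw (f := fun h => ‖‖h‖ ^ 2 - ‖y‖ ^ 2‖ₑ ^ 2) (by fun_prop)]
  simp only [hfactor, enorm_mul, mul_pow]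
  rw [lintegral_const_mul _ (by fun_prop), lintegral_enorm_norm_sq_sub_finrank_sq_stdGaussian,
    ← enorm_pow, Real.enorm_eq_ofReal (by positivity), ← ENNReal.ofReal_mul (by positivity), hrank]
  congr 1
  push_cast
  field_simp

end GinibreLaw

section IsGinibre

variable {Ω : Type*} [MeasurableSpace Ω] {P : Measure Ω}

theorem hasLaw_toLp_stdGaussian {ι : Type*} [Fintype ι] {X : ι → Ω → ℝ}
    (hX : ∀ i, HasLaw (X i) (gaussianReal 0 1) P) (hind : iIndepFun X P) :
    HasLaw (fun ω => WithLp.toLp 2 fun i => X i ω) (stdGaussian (EuclideanSpace ℝ ι)) P :=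
  HasLaw.comp ⟨Measurable.aemeasurable (by fun_prop), map_pi_eq_stdGaussian⟩ (hind.hasLaw_pi hX)

theorem hasLaw_star_add_I_mul_stdGaussian {n : Type*} [Fintype n] :
    HasLaw (fun p : EuclideanSpace ℝ (n × n) × EuclideanSpace ℝ (n × n) =>
        WithLp.toLp 2 fun i =>
          WithLp.toLp 2 fun j => star ((p.1 (i, j) : ℂ) + Complex.I * (p.2 (i, j) : ℂ)))
      (stdGaussian (PiLp 2 fun _ : n => EuclideanSpace ℂ n))
      ((stdGaussian (EuclideanSpace ℝ (n × n))).prod (stdGaussian (EuclideanSpace ℝ (n × n)))) := by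
  refine ⟨Measurable.aemeasurable (Continuous.measurable (by fun_prop)), ?_⟩
  have hsum := map_add_stdGaussian_prod (H := PiLp 2 fun _ : n => EuclideanSpace ℂ n)
    (K := fun x : EuclideanSpace ℝ (n × n) =>
      WithLp.toLp 2 fun i => WithLp.toLp 2 fun j => (x (i, j) : ℂ))
    (L := fun x : EuclideanSpace ℝ (n × n) =>
      WithLp.toLp 2 fun i => WithLp.toLp 2 fun j => -Complex.I * (x (i, j) : ℂ))
    (K' := fun t => WithLp.toLp 2 fun ij => (t ij.1 ij.2).re)
    (L' := fun t => WithLp.toLp 2 fun ij => -(t ij.1 ij.2).im)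
    (Continuous.measurable (by fun_prop)) (Continuous.measurable (by fun_prop))
    (fun x t => by simp [PiLp.inner_apply, Fintype.sum_prod_type, Complex.inner])
    (fun x t => by simp [PiLp.inner_apply, Fintype.sum_prod_type, Complex.inner])
    fun t => by
      simp [EuclideanSpace.norm_sq_eq, PiLp.norm_sq_eq_of_L2 fun _ : n => EuclideanSpace ℂ n,
        Fintype.sum_prod_type, ← Finset.sum_add_distrib, Complex.sq_norm, Complex.normSq_apply,
        ← sq]
  rw [← hsum]
  refine congrArg (Measure.map · _) (funext fun p => ?_)
  ext i j
  simp

theorem toEuclideanCLM_eq_ofRows {n : Type*} [Fintype n] [DecidableEq n] (A : Matrix n n ℂ) :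
    Matrix.toEuclideanCLM (𝕜 := ℂ) A =
      ofRows (WithLp.toLp 2 fun i => WithLp.toLp 2 fun j => star (A i j)) := by
  ext x i
  rw [ofRows_apply, Matrix.ofLp_toEuclideanCLM, Matrix.mulVec, dotProduct, PiLp.inner_apply]
  simp [RCLike.inner_apply, mul_comm]

variable {N : ℕ} {G : Ω → Matrix (Fin N) (Fin N) ℂ}

theorem IsGinibre.isProbabilityMeasure (hG : IsGinibre P G) : IsProbabilityMeasure P := by
  obtain ⟨X, Y, -, -, hXind, -⟩ := hG
  exact hXind.isProbabilityMeasure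

theorem IsGinibre.hasLaw_toEuclideanCLM (hG : IsGinibre P G) :
    HasLaw (fun ω => Matrix.toEuclideanCLM (𝕜 := ℂ) (G ω)) (ginibreLaw (Fin N)) P := by
  have := hG.isProbabilityMeasure
  obtain ⟨X, Y, hX, hY, hXind, hYind, hXY, hGXY⟩ := hG
  let vec (M : Fin N → Fin N → ℝ) : EuclideanSpace ℝ (Fin N × Fin N) :=
    WithLp.toLp 2 fun ij => M ij.1 ij.2
  have hvec : Measurable vec := by fun_prop
  have hpair : HasLaw (fun ω => (vec (X ω), vec (Y ω))) ((stdGaussian _).prod (stdGaussian _)) P :=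
    (hXY.comp hvec hvec).hasLaw_prod
      (hasLaw_toLp_stdGaussian (fun ij : Fin N × Fin N => hX ij.1 ij.2) hXind)
      (hasLaw_toLp_stdGaussian (fun ij : Fin N × Fin N => hY ij.1 ij.2) hYind)
  have hop : HasLaw (fun a => ((√(2 * Fintype.card (Fin N)) : ℝ) : ℂ)⁻¹ • ofRows a)
      (ginibreLaw (Fin N)) (stdGaussian _) :=
    ⟨(measurable_smul_ofRows _).aemeasurable, rfl⟩
  convert hop.fun_comp (hasLaw_star_add_I_mul_stdGaussian.fun_comp hpair) using 2 with ω
  have hGω : G ω = ((√(2 * Fintype.card (Fin N)) : ℝ) : ℂ)⁻¹ •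
      Matrix.of fun i j => (X ω i j : ℂ) + Complex.I * (Y ω i j : ℂ) := by
    ext i j
    rw [hGXY, Fintype.card_fin, Matrix.smul_apply, smul_eq_mul, Matrix.of_apply]
  rw [hGω, map_smul, toEuclideanCLM_eq_ofRows]
  rfl

theorem IsGinibre.hasLaw_toEuclideanCLM_prod (hG : IsGinibre P G)
    {b : Ω → EuclideanSpace ℂ (Fin N)} (hb : AEMeasurable b P)
    (hind : IndepFun b (fun ω i j => G ω i j) P) :
    HasLaw (fun ω => (Matrix.toEuclideanCLM (𝕜 := ℂ) (G ω), b ω))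
      ((ginibreLaw (Fin N)).prod (P.map b)) P := by
  have := hG.isProbabilityMeasure
  have hCLM : Measurable fun A : Fin N → Fin N → ℂ =>
      Matrix.toEuclideanCLM (n := Fin N) (𝕜 := ℂ) (Matrix.of A) := by
    simp only [toEuclideanCLM_eq_ofRows]
    exact (continuous_ofRows.comp (by fun_prop)).measurable
  exact (hind.symm.comp hCLM measurable_id).hasLaw_prod hG.hasLaw_toEuclideanCLM ⟨hb, rfl⟩

end IsGinibre

section ArnoldiLimits

theorem lintegral_le_of_hasLaw_prod {Ω α β : Type*} [MeasurableSpace Ω] [MeasurableSpace α]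
    [MeasurableSpace β] {P : Measure Ω} {μ : Measure α} [SFinite μ] {ν : Measure β}
    [IsProbabilityMeasure ν] {X : Ω → α × β} (hX : HasLaw X (μ.prod ν) P) {f : α × β → ℝ≥0∞}
    (hf : Measurable f) {C : ℝ≥0∞} (hC : ∀ y, ∫⁻ x, f (x, y) ∂μ ≤ C) : ∫⁻ ω, f (X ω) ∂P ≤ C := by
  rw [hX.lintegral_comp hf.aemeasurable, lintegral_prod_symm _ hf.aemeasurable]
  exact (lintegral_mono hC).trans_eq (by simp)

theorem lintegral_enorm_inner_arnoldiVec_apply_sq_le {n : Type*} [Fintype n] [DecidableEq n]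
    (b : EuclideanSpace ℂ n) {i j : ℕ} (hij : i ≤ j) :
    ∫⁻ T, ‖⟪arnoldiVec T b i, T (arnoldiVec T b j)⟫_ℂ‖ₑ ^ 2 ∂ginibreLaw n ≤
      ENNReal.ofReal (1 / Fintype.card n) := by
  rw [isResampleInvariant_ginibreLaw.lintegral_arnoldiVec b hij
    (f := fun p => ‖⟪p.1, p.2.2⟫_ℂ‖ₑ ^ 2) (by fun_prop)]
  simp only [lintegral_enorm_inner_apply_sq_ginibreLaw]
  refine (lintegral_mono (g := fun _ => ENNReal.ofReal (1 / Fintype.card n)) fun T => ?_).trans_eq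
    (by simp)
  refine ENNReal.ofReal_le_ofReal (div_le_div_of_nonneg_right ?_ (by positivity))
  exact mul_le_one₀ (pow_le_one₀ (norm_nonneg _) (norm_arnoldiVec_le_one T b i)) (sq_nonneg _)
    (pow_le_one₀ (norm_nonneg _) (norm_arnoldiVec_le_one T b j))

theorem lintegral_enorm_norm_apply_arnoldiVec_sq_sub_sq_le {n : Type*} [Fintype n] [DecidableEq n]
    [Nonempty n] (b : EuclideanSpace ℂ n) (j : ℕ) :
    ∫⁻ T, ‖‖T (arnoldiVec T b j)‖ ^ 2 - ‖arnoldiVec T b j‖ ^ 2‖ₑ ^ 2 ∂ginibreLaw n ≤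
      ENNReal.ofReal (Var[fun x => x ^ 2; gaussianReal 0 1] / (2 * Fintype.card n)) := by
  rw [isResampleInvariant_ginibreLaw.lintegral_arnoldiVec b le_rfl
    (f := fun p => ‖‖p.2.2‖ ^ 2 - ‖p.2.1‖ ^ 2‖ₑ ^ 2) (by fun_prop)]
  simp only [lintegral_enorm_norm_apply_sq_sub_sq_ginibreLaw]
  refine (lintegral_mono (g := fun _ => ENNReal.ofReal
    (Var[fun x => x ^ 2; gaussianReal 0 1] / (2 * Fintype.card n))) fun T => ?_).trans_eq (by simp)
  refine ENNReal.ofReal_le_ofReal (div_le_div_of_nonneg_right ?_ (by positivity))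
  exact mul_le_of_le_one_left (variance_nonneg _ _)
    (pow_le_one₀ (norm_nonneg _) (norm_arnoldiVec_le_one T b j))

variable {Ω : Type*} [MeasurableSpace Ω] {P : Measure Ω}
  {T : (N : ℕ) → Ω → EuclideanSpace ℂ (Fin N) →L[ℂ] EuclideanSpace ℂ (Fin N)}
  {b : (N : ℕ) → Ω → EuclideanSpace ℂ (Fin N)}
  {ν : (N : ℕ) → Measure (EuclideanSpace ℂ (Fin N))} [∀ N, IsProbabilityMeasure (ν N)]

theorem tendsto_inner_arnoldiVec_apply_of_le
    (hTb : ∀ N, HasLaw (fun ω => (T N ω, b N ω)) ((ginibreLaw (Fin N)).prod (ν N)) P)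
    {i j : ℕ} (hij : i ≤ j) :
    Tendsto (fun z : ℕ × Ω => ⟪arnoldiVec (T z.1 z.2) (b z.1 z.2) i,
      T z.1 z.2 (arnoldiVec (T z.1 z.2) (b z.1 z.2) j)⟫_ℂ) (inMeasure P atTop) (𝓝 0) := by
  refine tendsto_inMeasure_zero_of_lintegral_enorm_sq (X := fun N ω =>
      ⟪arnoldiVec (T N ω) (b N ω) i, T N ω (arnoldiVec (T N ω) (b N ω) j)⟫_ℂ)
    (fun N => ?_) (tendsto_of_tendsto_of_tendsto_of_le_of_le tendsto_const_nhds
      (h := fun N : ℕ => ENNReal.ofReal (1 / N)) ?_ (fun _ => zero_le) fun N => ?_)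
  · exact ((measurable_inner_arnoldiVec_apply i j).comp_aemeasurable
      (hTb N).aemeasurable).aestronglyMeasurable
  · simpa using ENNReal.tendsto_ofReal tendsto_one_div_atTop_nhds_zero_nat
  · refine lintegral_le_of_hasLaw_prod (hTb N)
      ((measurable_inner_arnoldiVec_apply i j).enorm.pow_const 2) fun y => ?_
    simpa using lintegral_enorm_inner_arnoldiVec_apply_sq_le y hij

theorem tendsto_norm_apply_arnoldiVec_sq_sub_sq
    (hTb : ∀ N, HasLaw (fun ω => (T N ω, b N ω)) ((ginibreLaw (Fin N)).prod (ν N)) P) (j : ℕ) :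
    Tendsto (fun z : ℕ × Ω => ‖T z.1 z.2 (arnoldiVec (T z.1 z.2) (b z.1 z.2) j)‖ ^ 2 -
      ‖arnoldiVec (T z.1 z.2) (b z.1 z.2) j‖ ^ 2) (inMeasure P atTop) (𝓝 0) := by
  refine tendsto_inMeasure_zero_of_lintegral_enorm_sq (X := fun N ω =>
      ‖T N ω (arnoldiVec (T N ω) (b N ω) j)‖ ^ 2 - ‖arnoldiVec (T N ω) (b N ω) j‖ ^ 2)
    (fun N => ?_) (tendsto_of_tendsto_of_tendsto_of_le_of_le' tendsto_const_nhds
      (h := fun N : ℕ => ENNReal.ofReal (Var[fun x => x ^ 2; gaussianReal 0 1] / (2 * N))) ?_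
      (.of_forall fun _ => zero_le) ?_)
  · exact ((measurable_norm_apply_arnoldiVec_sq_sub_sq j).comp_aemeasurable
      (hTb N).aemeasurable).aestronglyMeasurable
  · simpa using ENNReal.tendsto_ofReal
      (tendsto_natCast_atTop_atTop.const_mul_atTop two_pos |>.const_div_atTop _)
  · filter_upwards [eventually_ge_atTop 1] with N hN
    have : NeZero N := ⟨by omega⟩
    refine lintegral_le_of_hasLaw_prod (hTb N)
      ((measurable_norm_apply_arnoldiVec_sq_sub_sq j).enorm.pow_const 2) fun y => ?_
    simpa using lintegral_enorm_norm_apply_arnoldiVec_sq_sub_sq_le y j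

theorem tendsto_norm_arnoldiResidual_succ
    (hTb : ∀ N, HasLaw (fun ω => (T N ω, b N ω)) ((ginibreLaw (Fin N)).prod (ν N)) P) {j : ℕ}
    (hj : Tendsto (fun z : ℕ × Ω => ‖arnoldiVec (T z.1 z.2) (b z.1 z.2) j‖)
      (inMeasure P atTop) (𝓝 1)) :
    Tendsto (fun z : ℕ × Ω => ‖arnoldiResidual (T z.1 z.2) (b z.1 z.2) (j + 1)‖)
      (inMeasure P atTop) (𝓝 1) := by
  have hcoeff := tendsto_finsetSum (Finset.range (j + 1)) fun i hi =>
    (tendsto_inner_arnoldiVec_apply_of_le hTb (Finset.mem_range_succ_iff.1 hi)).norm.pow 2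
  have hsq := (((tendsto_norm_apply_arnoldiVec_sq_sub_sq hTb j).add (hj.pow 2)).sub hcoeff).sqrt
  simpa only [sub_add_cancel, ← norm_arnoldiResidual_succ_sq, Real.sqrt_sq (norm_nonneg _),
    norm_zero, zero_pow two_ne_zero, Finset.sum_const_zero, zero_add, sub_zero, one_pow,
    Real.sqrt_one] using hsq

theorem tendsto_norm_arnoldiVec
    (hTb : ∀ N, HasLaw (fun ω => (T N ω, b N ω)) ((ginibreLaw (Fin N)).prod (ν N)) P)
    (hb : ∀ᶠ N in atTop, ∀ᵐ ω ∂P, b N ω ≠ 0) (j : ℕ) :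
    Tendsto (fun z : ℕ × Ω => ‖arnoldiVec (T z.1 z.2) (b z.1 z.2) j‖)
      (inMeasure P atTop) (𝓝 1) := by
  induction j with
  | zero =>
    refine tendsto_const_nhds.congr' ?_
    filter_upwards [eventually_inMeasure_of_ae (p := fun z => b z.1 z.2 ≠ 0) hb] with z hz using
      (norm_arnoldiVec_zero (T z.1 z.2) hz).symm
  | succ j ih =>
    have hres := tendsto_norm_arnoldiResidual_succ hTb ih
    simpa only [norm_arnoldiVec, inv_one, mul_one] using (hres.inv₀ one_ne_zero).mul hres

theorem tendsto_inner_arnoldiVec_apply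
    (hTb : ∀ N, HasLaw (fun ω => (T N ω, b N ω)) ((ginibreLaw (Fin N)).prod (ν N)) P)
    (hb : ∀ᶠ N in atTop, ∀ᵐ ω ∂P, b N ω ≠ 0) (i j : ℕ) :
    Tendsto (fun z : ℕ × Ω => ⟪arnoldiVec (T z.1 z.2) (b z.1 z.2) i,
      T z.1 z.2 (arnoldiVec (T z.1 z.2) (b z.1 z.2) j)⟫_ℂ)
      (inMeasure P atTop) (𝓝 (if i = j + 1 then 1 else 0)) := by
  rcases le_or_gt i j with hij | hij
  · rw [if_neg (by omega)]
    exact tendsto_inner_arnoldiVec_apply_of_le hTb hij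
  rcases hij.nat_succ_le.eq_or_lt with rfl | hij
  · rw [if_pos rfl]
    simpa only [inner_arnoldiVec_succ_apply, RCLike.ofReal_one, Function.comp_def] using
      (RCLike.continuous_ofReal.tendsto 1).comp
        (tendsto_norm_arnoldiResidual_succ hTb (tendsto_norm_arnoldiVec hTb hb j))
  · rw [if_neg (by omega)]
    simpa only [inner_arnoldiVec_apply_of_lt _ _ hij] using tendsto_const_nhds

theorem tendsto_inner_arnoldiVec_pow_apply
    (hTb : ∀ N, HasLaw (fun ω => (T N ω, b N ω)) ((ginibreLaw (Fin N)).prod (ν N)) P)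
    (hb : ∀ᶠ N in atTop, ∀ᵐ ω ∂P, b N ω ≠ 0) (i m : ℕ) :
    Tendsto (fun z : ℕ × Ω => ⟪arnoldiVec (T z.1 z.2) (b z.1 z.2) i,
      (T z.1 z.2 ^ m) (arnoldiVec (T z.1 z.2) (b z.1 z.2) 0)⟫_ℂ)
      (inMeasure P atTop) (𝓝 (if i = m then 1 else 0)) := by
  induction m generalizing i with
  | zero =>
    rcases eq_or_ne i 0 with rfl | hi
    · simpa [inner_self_eq_norm_sq_to_K] using ((tendsto_norm_arnoldiVec hTb hb 0).ofReal.pow 2)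
    · simpa [hi, inner_arnoldiVec_of_ne _ _ hi] using tendsto_const_nhds
  | succ m ih =>
    have hexpand (z : ℕ × Ω) : ⟪arnoldiVec (T z.1 z.2) (b z.1 z.2) i,
        (T z.1 z.2 ^ (m + 1)) (arnoldiVec (T z.1 z.2) (b z.1 z.2) 0)⟫_ℂ =
        ∑ l ∈ Finset.range (m + 1), ⟪arnoldiVec (T z.1 z.2) (b z.1 z.2) l,
          (T z.1 z.2 ^ m) (arnoldiVec (T z.1 z.2) (b z.1 z.2) 0)⟫_ℂ *
          ⟪arnoldiVec (T z.1 z.2) (b z.1 z.2) i,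
            T z.1 z.2 (arnoldiVec (T z.1 z.2) (b z.1 z.2) l)⟫_ℂ := by
      rw [pow_succ', mul_apply_eq_comp]
      nth_rw 1 [pow_apply_arnoldiVec_zero_eq_sum (T z.1 z.2) _ m.lt_succ_self]
      simp only [map_sum, map_smul, inner_sum, inner_smul_right]
    simp only [hexpand]
    convert tendsto_finsetSum (Finset.range (m + 1)) fun l _ =>
      (ih l).mul (tendsto_inner_arnoldiVec_apply hTb hb i l)
    simp [Finset.sum_ite]

theorem tendsto_inner_pow_apply_arnoldiVec_zero
    (hTb : ∀ N, HasLaw (fun ω => (T N ω, b N ω)) ((ginibreLaw (Fin N)).prod (ν N)) P)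
    (hb : ∀ᶠ N in atTop, ∀ᵐ ω ∂P, b N ω ≠ 0) (i j : ℕ) :
    Tendsto (fun z : ℕ × Ω => ⟪(T z.1 z.2 ^ i) (arnoldiVec (T z.1 z.2) (b z.1 z.2) 0),
      (T z.1 z.2 ^ j) (arnoldiVec (T z.1 z.2) (b z.1 z.2) 0)⟫_ℂ)
      (inMeasure P atTop) (𝓝 (if i = j then 1 else 0)) := by
  have hexpand (z : ℕ × Ω) : ⟪(T z.1 z.2 ^ i) (arnoldiVec (T z.1 z.2) (b z.1 z.2) 0),
      (T z.1 z.2 ^ j) (arnoldiVec (T z.1 z.2) (b z.1 z.2) 0)⟫_ℂ =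
      ∑ l ∈ Finset.range (i + 1), star ⟪arnoldiVec (T z.1 z.2) (b z.1 z.2) l,
        (T z.1 z.2 ^ i) (arnoldiVec (T z.1 z.2) (b z.1 z.2) 0)⟫_ℂ *
        ⟪arnoldiVec (T z.1 z.2) (b z.1 z.2) l,
          (T z.1 z.2 ^ j) (arnoldiVec (T z.1 z.2) (b z.1 z.2) 0)⟫_ℂ := by
    nth_rw 1 [pow_apply_arnoldiVec_zero_eq_sum (T z.1 z.2) _ i.lt_succ_self]
    simp only [sum_inner, inner_smul_left, starRingEnd_apply]
  simp only [hexpand]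
  convert tendsto_finsetSum (Finset.range (i + 1)) fun l _ =>
    (tendsto_inner_arnoldiVec_pow_apply hTb hb l i).star.mul
      (tendsto_inner_arnoldiVec_pow_apply hTb hb l j)
  simp only [star_one, apply_ite (star : ℂ → ℂ), star_zero, ite_mul, one_mul, zero_mul,
    Finset.sum_ite_eq', Finset.self_mem_range_succ, if_true]

end ArnoldiLimits

theorem mainTheorem1_general {Ω : Type*} [MeasurableSpace Ω] (P : Measure Ω)
    (G : (N : ℕ) → Ω → Matrix (Fin N) (Fin N) ℂ) (hG : ∀ N, IsGinibre P (G N))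
    (b : (N : ℕ) → Ω → EuclideanSpace ℂ (Fin N)) (hb : ∀ N, AEMeasurable (b N) P)
    (hb0 : ∀ N, 1 ≤ N → ∀ᵐ ω ∂P, b N ω ≠ 0)
    (hind : ∀ N, IndepFun (b N) (fun ω i j => G N ω i j) P)
    (σ : ℂ) (hσ : σ ≠ 0) (k : ℕ) :
    TendstoInMeasure P
      (fun N ω => gmresResidualNorm (1 + σ • G N ω) (b N ω) k / ‖b N ω‖)
      atTop
      (fun _ => ‖σ‖ ^ k / √(∑ i ∈ Finset.range (k + 1), ‖σ‖ ^ (2 * i))) := by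
  have := (hG 0).isProbabilityMeasure
  have (N : ℕ) : IsProbabilityMeasure (P.map (b N)) := Measure.isProbabilityMeasure_map (hb N)
  have hne : ∀ᶠ N in atTop, ∀ᵐ ω ∂P, b N ω ≠ 0 := (eventually_ge_atTop 1).mono hb0
  have hgram := tendsto_inner_pow_apply_arnoldiVec_zero
    (fun N => (hG N).hasLaw_toEuclideanCLM_prod (hb N) (hind N)) hne
  have herror := (tendsto_finsetSum (Finset.range (k + 1)) fun i _ =>
    tendsto_finsetSum (Finset.range (k + 1)) fun j _ =>
      ((hgram i j).sub_const (if i = j then 1 else 0)).norm).mul_const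
        (∑ i ∈ Finset.range (k + 1), ‖(-σ⁻¹) ^ i‖ ^ 2)⁻¹
  simp only [sub_self, norm_zero, Finset.sum_const_zero, zero_mul] at herror
  have hsq : Tendsto (fun z : ℕ × Ω =>
      (gmresResidualNorm (1 + σ • G z.1 z.2) (b z.1 z.2) k / ‖b z.1 z.2‖) ^ 2)
      (inMeasure P atTop) (𝓝 (∑ i ∈ Finset.range (k + 1), ‖(-σ⁻¹) ^ i‖ ^ 2)⁻¹) := by
    refine tendsto_iff_norm_sub_tendsto_zero.2 (squeeze_zero' (.of_forall fun _ => norm_nonneg _)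
      ?_ herror)
    filter_upwards [eventually_inMeasure_of_ae (p := fun z => b z.1 z.2 ≠ 0) hne] with z hz using
      abs_gmresResidualNorm_div_sq_sub_le (G z.1 z.2) hz hσ k
  rw [inv_sum_norm_neg_inv_pow_sq_eq_div hσ] at hsq
  simpa only [tendstoInMeasure_const_iff, Real.sqrt_sq (div_nonneg (gmresResidualNorm_nonneg _ _ _)
    (norm_nonneg _)), Real.sqrt_div (sq_nonneg _), Real.sqrt_sq (pow_nonneg (norm_nonneg σ) k)]
    using hsq.sqrt

theorem mainTheorem1 {Ω : Type*} [MeasurableSpace Ω] (P : Measure Ω) [IsProbabilityMeasure P]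
    (G : (N : ℕ) → Ω → Matrix (Fin N) (Fin N) ℂ) (hG : ∀ N, IsGinibre P (G N))
    (b : (N : ℕ) → Ω → EuclideanSpace ℂ (Fin N)) (hb : ∀ N, AEMeasurable (b N) P)
    (hb0 : ∀ N, 1 ≤ N → ∀ᵐ ω ∂P, b N ω ≠ 0)
    (hind : ∀ N, IndepFun (b N) (fun ω i j => G N ω i j) P)
    (σ : ℝ) (hσ : σ ∈ Set.Ioo (0 : ℝ) 1) (k : ℕ) :
    TendstoInMeasure P
      (fun N ω => gmresResidualNorm (1 + (σ : ℂ) • G N ω) (b N ω) k / ‖b N ω‖)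
      atTop
      (fun _ => √((1 - σ ^ 2) / (1 - σ ^ (2 + 2 * k))) * σ ^ k) := by
  simpa only [sqrt_inv_geom_sum_mul_pow_eq hσ, Complex.norm_of_nonneg hσ.1.le] using
    mainTheorem1_general P G hG b hb hb0 hind σ (Complex.ofReal_ne_zero.2 hσ.1.ne') k
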